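/- **Setting.** $\mathbb R^q$ ($q\ge 1$) carries the $\ell_1$ norm $\|\cdot\|$ with closed unit ball $B_1(0)$; $\operatorname{cone}A$ is the convex conic hull ($\operatorname{cone}\emptyset=\{0\}$), $A^+=\{z: z^{\mathsf T}y\ge 0\ \forall y\in A\}$, and $A_\infty=\{d: y+\alpha d\in A\ \forall y\in A,\ \alpha\ge 0\}$. Consider the problem (P) minimize $\Gamma(x)$ with respect to $\le_C$ subject to $x\in\mathcal X$, where $\mathcal X\subseteq\mathbb R^n$ is closed and convex with nonempty interior, $C\subseteq\mathbb R^q$ is a closed, convex, non-trivial, pointed, solid, polyhedral cone, and $\Gamma:\mathcal X\to\mathbb R^q$ is continuous and $C$-convex. Its upper image is $\mathcal P=\operatorname{cl}(\Gamma(\mathcal X)+C)$. Fix $c\in\operatorname{int}C$ with $\|c\|=1$, a nonsingular $T\in\mathbb R^{q\times q}$ with last column $c$, a finite set $R$ with $\operatorname{cone}R=C$ and $\|d\|=1$ for $d\in R$, a finite set $R^*$ with $\operatorname{cone}R^*=C^+$ and $c^{\mathsf T}z=1$ for $z\in R^*$, and tolerances $\varepsilon,\delta>0$. Scalarizations: $(P_1(w))$: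 minimize $w^{\mathsf T}\Gamma(x)$ over $x\in\mathcal X$. For an ordering cone $Q$ (either $C$ or $\operatorname{cone}\mathcal Y$), $(P_2^Q(v,d))$, $d\neq 0$: maximize $z$ subject to $x\in\mathcal X$, $z\in\mathbb R$, $v+zd-\Gamma(x)\in Q$; its dual $(D_2^Q(v,d))$: minimize $\sup_{x\in\mathcal X}\{-w^{\mathsf T}\Gamma(x)\}+w^{\mathsf T}v$ subject to $w^{\mathsf T}d=-1$, $w\in Q^+$. Write $H(w,x)=\{y: w^{\mathsf T}(y-\Gamma(x))\ge 0\}$. **Phase 1.** Start with $\mathcal Y_{In}=R$, $\hat C=\emptyset$, $\mathcal P_0=\mathbb R^q$, $\bar{\mathcal X}=\bar{\mathcal T}=\emptyset$; choose $x_0\in\mathcal X$ and put $v=\Gamma(x_0)+\sum_{d\in R}d$. (i) For every $z\in R^*$ solve $(P_1(z))$; if it has an optimal solution $x$, add $x$ to $\bar{\mathcal X}$ and $T^{\mathsf T}z$ to $\bar{\mathcal T}$, and replace $\mathcal P_0$ by $\mathcal P_0\cap H(z,x)$. If none of these problems is unbounded, set $\mathcal Y_{Out}=R$ and end Phase 1.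 (ii) Otherwise, for every $d\in -R$ solve $(P_2^C(v,d))$ and $(D_2^C(v,d))$. If the former is unbounded, add $d$ to $\mathcal Y_{In}$; if they have optimal solutions $(x,z)$ and $w$, add $x$ to $\bar{\mathcal X}$ and $T^{\mathsf T}w/(c^{\mathsf T}w)$ to $\bar{\mathcal T}$, and replace $\mathcal P_0$ by $\mathcal P_0\cap H(w,x)$. Then set $\mathcal Y_{Out}=\operatorname{vert}((\mathcal P_0)_\infty\cap B_1(0))\setminus\{0\}$. (iii) While $\mathcal Y_{Out}\setminus(\mathcal Y_{In}\cup\hat C)\ne\emptyset$, take $d$ in this set and $\tilde r\in\mathcal Y_{In}$ nearest to $d$. If $\|d-\tilde r\|\le\delta$, add $d$ to $\hat C$. Otherwise choose $\lambda\in(0,1)$ with $e=\lambda d+(1-\lambda)\tilde r\neq 0$: if $(P_2^C(v,e))$ is unbounded, add $e/\|e\|$ to $\mathcal Y_{In}$; if $(P_2^C(v,e))$, $(D_2^C(v,e))$ have optimal solutions, update $\bar{\mathcal X},\bar{\mathcal T},\mathcal P_0$ as in (ii) and recompute $\mathcal Y_{Out}$. **Phase 2** (iterations on the problem (P') obtained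 from (P) by replacing $C$ with $\operatorname{cone}\mathcal Y_{Out}$). Set $k=0$. Repeat: let $M=\mathbb R^q$ and compute a V-representation $\mathcal P_k=\operatorname{conv}V+\operatorname{cone}D$, with $V$ finite and nonempty and $D$ a finite set of nonzero directions (if $\mathcal P_k$ contains no line, $V$ may be its set of vertices). For every $v\in V$ compute optimal solutions $(x,z)$ of $(P_2^{\operatorname{cone}\mathcal Y_{Out}}(v,-c))$ and $w$ of $(D_2^{\operatorname{cone}\mathcal Y_{Out}}(v,-c))$, add $x$ to $\bar{\mathcal X}$ and $T^{\mathsf T}w$ to $\bar{\mathcal T}$, and, if $-z>\varepsilon$, replace $M$ by $M\cap H(w,x)$. If $M\ne\mathbb R^q$, set $\mathcal P_{k+1}=\mathcal P_k\cap M$, increase $k$ by one and repeat; otherwise stop and output $\bar{\mathcal X},\mathcal Y_{Out},\bar{\mathcal T}$. The algorithm *terminates* if all loops end after finitely many steps and every scalarization that is not found to be unbounded is solved by optimal solutions as prescribed. **Geometric dual.** Let $K=\mathbb R_+e^q$, $w(t)=((t_1,\dots,t_{q-1},1)T^{-1})^{\mathsf T}$ and $D^*(t)=(t_1,\dots,t_{q-1},\inf_{x\in\mathcal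 X}w(t)^{\mathsf T}\Gamma(x))^{\mathsf T}\in\mathbb R^{q-1}\times[-\infty,\infty]$. The geometric dual (D) is: maximize $D^*(t)$ with respect to $\le_K$ subject to $w(t)\in C^+$. For a set $\mathcal Y$, the modified dual (D') has the constraint $w(t)\in(\operatorname{cone}\mathcal Y)^+$ instead; let $\mathcal T'$ be its feasible set and $\mathcal D'=D^*(\mathcal T')-K$. A finite $\varepsilon$-solution of (D') is a finite set $\bar{\mathcal T}\subseteq\mathcal T'$ such that $D^*(t)$ is a $K$-maximal element of $D^*(\mathcal T')$ for all $t\in\bar{\mathcal T}$ and $\operatorname{conv}D^*(\bar{\mathcal T})-K+\varepsilon\{e^q\}\supseteq\mathcal D'$. A pair $(\bar{\mathcal T},\mathcal Y)$ is a finite $(\varepsilon,\delta)$-solution of (D) if $\mathcal Y$ is finite, $\mathcal P_\infty\subseteq\operatorname{cone}\mathcal Y$, the Hausdorff distance of $\mathcal P_\infty\cap B_1(0)$ and $\operatorname{cone}\mathcal Y\cap B_1(0)$ is at most $\delta$, and $\bar{\mathcal T}$ is a finite $\varepsilon$-solution of (D'). **Theorem.** If the algorithm terminates with output $\bar{\mathcal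 X},\mathcal Y_{Out},\bar{\mathcal T}$, then $(\bar{\mathcal T},\mathcal Y_{Out})$ is a finite $(\varepsilon,\delta)$-solution of (D). -/

import Mathlib

open scoped Pointwise Matrix

noncomputable section

namespace CVO

/-! ### Finite-dimensional preliminaries -/

/-- `ℝ^q` with the `ℓ₁` norm. -/
abbrev Vec (q : ℕ) : Type := PiLp 1 (fun _ : Fin q => ℝ)

/-- The scalar product `wᵀ y`. -/
def dot {q : ℕ} (w y : Vec q) : ℝ := ∑ i, w i * y i

/-- Convex conic hull, with `cone ∅ = {0}`. -/
def cone {q : ℕ} (A : Set (Vec q)) : Set (Vec q) :=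
  (PointedCone.hull ℝ A : Set (Vec q))

/-- Positive dual cone `A⁺`. -/
def dualCone {q : ℕ} (A : Set (Vec q)) : Set (Vec q) :=
  {z | ∀ y ∈ A, 0 ≤ dot z y}

/-- Recession cone `A_∞`. -/
def recessionCone {q : ℕ} (A : Set (Vec q)) : Set (Vec q) :=
  {d | ∀ y ∈ A, ∀ α : ℝ, 0 ≤ α → y + α • d ∈ A}

/-- The half-space `{y | wᵀ (y - a) ≥ 0}`. -/
def halfspace {q : ℕ} (w a : Vec q) : Set (Vec q) :=
  {y | 0 ≤ dot w (y - a)}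

/-- Polyhedral convex sets, through an H-representation. -/
def IsPolyhedral {q : ℕ} (A : Set (Vec q)) : Prop :=
  ∃ H : Finset (Vec q × ℝ), (∀ h ∈ H, h.1 ≠ 0) ∧ A = {y | ∀ h ∈ H, h.2 ≤ dot h.1 y}

/-- `V` is the set of points (vertices) of a V-representation of `A`:
`A = conv V + cone D`, with `V` finite and nonempty and `D` a finite set of nonzero directions.
For a polyhedron that contains no line, the set of its extreme points is such a `V`; a polyhedron
that contains a line has no extreme points, but still has such representations. -/
def IsVRepPoints {q : ℕ} (A : Set (Vec q)) (V : Finset (Vec q)) : Prop :=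
  V.Nonempty ∧ ∃ D : Finset (Vec q), (∀ k ∈ D, k ≠ 0) ∧
    A = convexHull ℝ (V : Set (Vec q)) + cone (D : Set (Vec q))

/-- `vert (A_∞ ∩ B₁(0)) \ {0}`; the vertices of a polytope are its extreme points. -/
def outerDirections {q : ℕ} (A : Set (Vec q)) : Set (Vec q) :=
  Set.extremePoints ℝ (recessionCone A ∩ Metric.closedBall 0 1) \ {0}

/-! ### Convex vector optimization problems -/

/-- The data of a vector optimization problem: minimize `Γ x` with respect to `≤_C` subject to
`x ∈ X`. Only the values of `Γ` on `X` matter. -/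
structure CVOP (n q : ℕ) where
  X : Set (Fin n → ℝ)
  Γ : (Fin n → ℝ) → Vec q
  C : Set (Vec q)

namespace CVOP

variable {n q : ℕ}

/-- Closed feasible set with interior points; closed, convex, non-trivial, pointed, solid and
polyhedral ordering cone; continuous `C`-convex objective. -/
structure StandingAssumption (P : CVOP n q) : Prop where
  X_closed : IsClosed P.X
  X_convex : Convex ℝ P.X
  X_interior : (interior P.X).Nonempty
  C_closed : IsClosed P.C
  C_cone : ∀ y ∈ P.C, ∀ α : ℝ, 0 < α → α • y ∈ P.C
  C_add : ∀ y ∈ P.C, ∀ y' ∈ P.C, y + y' ∈ P.C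
  C_ne_zero : {0} ⊂ P.C
  C_ne_univ : P.C ⊂ Set.univ
  C_pointed : ∀ y ∈ P.C, -y ∈ P.C → y = 0
  C_solid : (interior P.C).Nonempty
  C_polyhedral : IsPolyhedral P.C
  Γ_continuous : ContinuousOn P.Γ P.X
  Γ_convex : ∀ x ∈ P.X, ∀ y ∈ P.X, ∀ α : ℝ, 0 ≤ α → α ≤ 1 →
    α • P.Γ x + (1 - α) • P.Γ y - P.Γ (α • x + (1 - α) • y) ∈ P.C

/-- Upper image `cl (Γ(X) + C)`. -/
def upperImage (P : CVOP n q) : Set (Vec q) := closure (P.Γ '' P.X + P.C)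

/-- The same problem with the ordering cone replaced by `cone Y`. -/
def withCone (P : CVOP n q) (Y : Set (Vec q)) : CVOP n q := { P with C := cone Y }

/-- `Y` is a `δ`-outer approximation of `𝒫_∞`. (Both sets in the Hausdorff distance are bounded
and contain `0`.) -/
def IsOuterApprox (P : CVOP n q) (δ : ℝ) (Y : Set (Vec q)) : Prop :=
  recessionCone P.upperImage ⊆ cone Y ∧
  Metric.hausdorffDist (recessionCone P.upperImage ∩ Metric.closedBall 0 1)
    (cone Y ∩ Metric.closedBall 0 1) ≤ δ

/-! ### Scalarizations -/

/-- `x` is an optimal solution of the weighted sum scalarization (P₁(w)):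
minimize `wᵀ Γ(x)` subject to `x ∈ X`. -/
def P1Optimal (P : CVOP n q) (w : Vec q) (x : Fin n → ℝ) : Prop :=
  x ∈ P.X ∧ ∀ x' ∈ P.X, dot w (P.Γ x) ≤ dot w (P.Γ x')

def P1Unbounded (P : CVOP n q) (w : Vec q) : Prop :=
  ¬ BddBelow ((fun x => dot w (P.Γ x)) '' P.X)

/-- Feasible points of the Pascoletti-Serafini scalarization (P₂(v,d)):
maximize `z` subject to `x ∈ X`, `Γ(x) - v - z d ≤_C 0`. -/
def P2Feasible (P : CVOP n q) (v d : Vec q) (x : Fin n → ℝ) (z : ℝ) : Prop :=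
  x ∈ P.X ∧ v + z • d - P.Γ x ∈ P.C

def P2Optimal (P : CVOP n q) (v d : Vec q) (x : Fin n → ℝ) (z : ℝ) : Prop :=
  P.P2Feasible v d x z ∧ ∀ x' z', P.P2Feasible v d x' z' → z' ≤ z

def P2Unbounded (P : CVOP n q) (v d : Vec q) : Prop :=
  ¬ BddAbove {z : ℝ | ∃ x, P.P2Feasible v d x z}

/-- Feasible points of the Lagrangian dual (D₂(v,d)). -/
def D2Feasible (P : CVOP n q) (d w : Vec q) : Prop :=
  dot w d = -1 ∧ w ∈ dualCone P.C

/-- Objective `sup_{x ∈ X} (-wᵀ Γ(x)) + wᵀ v` of (D₂(v,d)). -/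
def D2Value (P : CVOP n q) (v w : Vec q) : EReal :=
  (⨆ x ∈ P.X, ((-(dot w (P.Γ x)) : ℝ) : EReal)) + ((dot w v : ℝ) : EReal)

def D2Optimal (P : CVOP n q) (v d w : Vec q) : Prop :=
  P.D2Feasible d w ∧ ∀ w', P.D2Feasible d w' → P.D2Value v w ≤ P.D2Value v w'

end CVOP

/-! ### Loops -/

/-- Sequential execution of a nondeterministic step for every element of a list. -/
inductive ForEach {α σ : Type} (step : α → σ → σ → Prop) : List α → σ → σ → Prop
  | nil (s : σ) : ForEach step [] s s
  | cons {a : α} {l : List α} {s s' s'' : σ} :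
      step a s s' → ForEach step l s' s'' → ForEach step (a :: l) s s''

/-- `l` lists every element of `A` exactly once. -/
def Enumerates {α : Type} (l : List α) (A : Finset α) : Prop :=
  l.Nodup ∧ ∀ a, a ∈ l ↔ a ∈ A

/-! ### First phase: outer approximation of the recession cone -/

/-- Variables of the first phase. -/
structure State1 (n q : ℕ) where
  YIn : Set (Vec q)
  Chat : Set (Vec q)
  YOut : Set (Vec q)
  P0 : Set (Vec q)
  Xbar : Set (Fin n → ℝ)
  Tbar : Set (Vec q)
  b : Bool

/-- `Tᵀ w`. -/
def tmul {q : ℕ} (T : Matrix (Fin q) (Fin q) ℝ) (w : Vec q) : Vec q :=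
  WithLp.toLp 1 (Tᵀ *ᵥ w.ofLp)

/-- Input of the algorithms besides the problem: the direction `c`, generating directions `R` of
`C` and `Rs` of `C⁺`, and the matrix `T`. -/
structure Input (q : ℕ) where
  c : Vec q
  R : Finset (Vec q)
  Rs : Finset (Vec q)
  T : Matrix (Fin q) (Fin q) ℝ

structure Input.Valid {n m : ℕ} (I : Input (m + 1)) (P : CVOP n (m + 1)) : Prop where
  c_interior : I.c ∈ interior P.C
  c_norm : ‖I.c‖ = 1
  R_generates : cone (I.R : Set (Vec (m + 1))) = P.C
  R_norm : ∀ d ∈ I.R, ‖d‖ = 1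
  Rs_generates : cone (I.Rs : Set (Vec (m + 1))) = dualCone P.C
  Rs_norm : ∀ z ∈ I.Rs, dot I.c z = 1
  T_nonsingular : IsUnit I.T.det
  T_last : ∀ i, I.T i (Fin.last m) = I.c i

section Phase1

variable {n q : ℕ} (P : CVOP n q) (I : Input q)

/-- `Y_In = R`, `Ĉ = ∅`, `P₀ = ℝ^q`, `X̄ = ∅`, `T̄ = ∅`, `b = 1`. -/
def initState : State1 n q where
  YIn := I.R
  Chat := ∅
  YOut := ∅
  P0 := Set.univ
  Xbar := ∅
  Tbar := ∅
  b := true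

/-- Boundedness check for one `z ∈ R*`. -/
def boundednessStep (z : Vec q) (s s' : State1 n q) : Prop :=
  (P.P1Unbounded z ∧ s' = { s with b := false }) ∨
  (∃ x, P.P1Optimal z x ∧
    s' = { s with
      Xbar := s.Xbar ∪ {x}
      Tbar := s.Tbar ∪ {tmul I.T z}
      P0 := s.P0 ∩ halfspace z (P.Γ x) })

/-- Check for lineality directions, for one `d ∈ -R`. -/
def linealityStep (v d : Vec q) (s s' : State1 n q) : Prop :=
  (P.P2Unbounded v d ∧ s' = { s with YIn := s.YIn ∪ {d} }) ∨
  (∃ x z w, P.P2Optimal v d x z ∧ P.D2Optimal v d w ∧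
    s' = { s with
      Xbar := s.Xbar ∪ {x}
      Tbar := s.Tbar ∪ {tmul I.T ((dot I.c w)⁻¹ • w)}
      P0 := s.P0 ∩ halfspace w (P.Γ x) })

/-- Treatment of the direction `e = λ d + (1 - λ) r̃` in the main loop. -/
def refineStep (v e : Vec q) (s s' : State1 n q) : Prop :=
  (P.P2Unbounded v e ∧ s' = { s with YIn := s.YIn ∪ {‖e‖⁻¹ • e} }) ∨
  (∃ x z w, P.P2Optimal v e x z ∧ P.D2Optimal v e w ∧
    s' = { s with
      Xbar := s.Xbar ∪ {x}
      Tbar := s.Tbar ∪ {tmul I.T ((dot I.c w)⁻¹ • w)}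
      P0 := s.P0 ∩ halfspace w (P.Γ x)
      YOut := outerDirections (s.P0 ∩ halfspace w (P.Γ x)) })

/-- One pass of the main loop. -/
def loopStep (δ : ℝ) (v : Vec q) (s s' : State1 n q) : Prop :=
  ∃ d ∈ s.YOut \ (s.YIn ∪ s.Chat), ∃ r ∈ s.YIn, (∀ r' ∈ s.YIn, ‖d - r‖ ≤ ‖d - r'‖) ∧
    ((‖d - r‖ ≤ δ ∧ s' = { s with Chat := s.Chat ∪ {d} }) ∨
     (δ < ‖d - r‖ ∧ ∃ l : ℝ, 0 < l ∧ l < 1 ∧ l • d + (1 - l) • r ≠ 0 ∧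
        refineStep P I v (l • d + (1 - l) • r) s s'))

/-- The first phase, run with tolerance `δ`, terminates with final values `out`. -/
def Phase1Terminates (δ : ℝ) (out : State1 n q) : Prop :=
  ∃ x₀ ∈ P.X, ∃ lz, Enumerates lz I.Rs ∧ ∃ s₃ : State1 n q,
    ForEach (boundednessStep P I) lz (initState I) s₃ ∧
    ((s₃.b = true ∧ out = { s₃ with YOut := (I.R : Set (Vec q)) }) ∨
     (s₃.b = false ∧ ∃ lr, Enumerates lr I.R ∧ ∃ s₅ : State1 n q,
        ForEach (linealityStep P I (P.Γ x₀ + ∑ d ∈ I.R, d)) (lr.map (fun r => -r)) s₃ s₅ ∧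
        Relation.ReflTransGen (loopStep P I δ (P.Γ x₀ + ∑ d ∈ I.R, d))
          { s₅ with YOut := outerDirections s₅.P0 } out ∧
        out.YOut \ (out.YIn ∪ out.Chat) = ∅))

end Phase1

/-! ### Second phase: primal algorithm -/

/-- Variables of the second phase; `Pk` is the current outer approximation. -/
structure State2 (n q : ℕ) where
  Pk : Set (Vec q)
  Xbar : Set (Fin n → ℝ)
  Tbar : Set (Vec q)
  M : Set (Vec q)

section Phase2

variable {n q : ℕ} (P : CVOP n q) (I : Input q)

/-- Treatment of one vertex `v`: the scalarizations of `P` in direction `-c` are solved; since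
(P₂) is a maximization problem, the distance from `v` to the upper image along `c` is `-z`. -/
def vertexStep (ε : ℝ) (v : Vec q) (s s' : State2 n q) : Prop :=
  ∃ x z w, P.P2Optimal v (-I.c) x z ∧ P.D2Optimal v (-I.c) w ∧
    ((ε < -z ∧ s' = { s with
        Xbar := s.Xbar ∪ {x}
        Tbar := s.Tbar ∪ {tmul I.T w}
        M := s.M ∩ halfspace w (P.Γ x) }) ∨
     (-z ≤ ε ∧ s' = { s with
        Xbar := s.Xbar ∪ {x}
        Tbar := s.Tbar ∪ {tmul I.T w} }))

/-- One pass of the while loop. -/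
def outerStep (ε : ℝ) (s s' : State2 n q) : Prop :=
  s.M ≠ Set.univ ∧ ∃ V : Finset (Vec q), IsVRepPoints s.Pk V ∧
    ∃ l, Enumerates l V ∧ ∃ s₁ : State2 n q,
      ForEach (vertexStep P I ε) l { s with M := Set.univ } s₁ ∧
      ((s₁.M ≠ Set.univ ∧ s' = { s₁ with Pk := s₁.Pk ∩ s₁.M }) ∨
       (s₁.M = Set.univ ∧ s' = s₁))

/-- The primal algorithm with tolerances `ε`, `δ` terminates with output `(X̄, Y_Out, T̄)`. The
second phase works on the modified problem, whose ordering cone is `cone Y_Out`. -/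
def PrimalAlgorithmTerminates (ε δ : ℝ) (Xbar : Set (Fin n → ℝ)) (YOut Tbar : Set (Vec q)) :
    Prop :=
  ∃ (s : State1 n q) (out : State2 n q), Phase1Terminates P I δ s ∧
    Relation.ReflTransGen (outerStep (P.withCone s.YOut) I ε)
      { Pk := s.P0, Xbar := s.Xbar, Tbar := s.Tbar, M := ∅ } out ∧
    out.M = Set.univ ∧ Xbar = out.Xbar ∧ YOut = s.YOut ∧ Tbar = out.Tbar

end Phase2

/-! ### Geometric dual problem -/

section Dual

variable {n m : ℕ}

/-- `w(t) = ((t₁, …, t_{q-1}, 1) T⁻¹)ᵀ`. -/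
def weight (T : Matrix (Fin (m + 1)) (Fin (m + 1)) ℝ) (t : Vec (m + 1)) : Vec (m + 1) :=
  WithLp.toLp 1 (Function.update t.ofLp (Fin.last m) 1 ᵥ* T⁻¹)

/-- `D*(t) = (t₁, …, t_{q-1}, inf_{x ∈ X} w(t)ᵀ Γ(x))`, with an extended real last entry. -/
def dualObjective (P : CVOP n (m + 1)) (T : Matrix (Fin (m + 1)) (Fin (m + 1)) ℝ)
    (t : Vec (m + 1)) : (Fin m → ℝ) × EReal :=
  (fun i => t i.castSucc, ⨅ x ∈ P.X, ((dot (weight T t) (P.Γ x) : ℝ) : EReal))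

/-- Feasible set `{t | w(t) ∈ C⁺}` of the geometric dual of `P`. -/
def dualFeasible (P : CVOP n (m + 1)) (T : Matrix (Fin (m + 1)) (Fin (m + 1)) ℝ) :
    Set (Vec (m + 1)) :=
  {t | weight T t ∈ dualCone P.C}

/-- The canonical embedding `ℝ^q → ℝ^{q-1} × [-∞, ∞]`. -/
def embed (y : Vec (m + 1)) : (Fin m → ℝ) × EReal :=
  (fun i => y i.castSucc, ((y (Fin.last m) : ℝ) : EReal))

/-- `e^q`. -/
def lastUnit (m : ℕ) : Vec (m + 1) := WithLp.toLp 1 (Pi.single (Fin.last m) 1)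

/-- `K = ℝ₊ e^q`. -/
def coneK (m : ℕ) : Set (Vec (m + 1)) := {y | ∃ k : ℝ, 0 ≤ k ∧ y = k • lastUnit m}

/-- `y` is a `K`-maximal element of `A`: `({y} + K \ {0}) ∩ A = ∅`. -/
def IsKMaximal (A : Set ((Fin m → ℝ) × EReal)) (y : (Fin m → ℝ) × EReal) : Prop :=
  y ∈ A ∧ ∀ k : ℝ, 0 < k → (y.1, y.2 + (k : EReal)) ∉ A

/-- Lower image `D*(𝒯) - K`. -/
def lowerImage (P : CVOP n (m + 1)) (T : Matrix (Fin (m + 1)) (Fin (m + 1)) ℝ) :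
    Set ((Fin m → ℝ) × EReal) :=
  {y | ∃ t ∈ dualFeasible P T, ∃ k : ℝ, 0 ≤ k ∧
    y = ((dualObjective P T t).1, (dualObjective P T t).2 - (k : EReal))}

/-- `Tbar` is a finite `ε`-solution of the geometric dual of `P`: finitely many feasible points
with `K`-maximal values and `conv D*(T̄) - K + ε {e^q} ⊇ 𝒟`. -/
def IsFiniteDualEpsSolution (P : CVOP n (m + 1)) (T : Matrix (Fin (m + 1)) (Fin (m + 1)) ℝ)
    (ε : ℝ) (Tbar : Set (Vec (m + 1))) : Prop :=
  Tbar.Finite ∧ Tbar ⊆ dualFeasible P T ∧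
  (∀ t ∈ Tbar, IsKMaximal (dualObjective P T '' dualFeasible P T) (dualObjective P T t)) ∧
  lowerImage P T ⊆
    embed '' (convexHull ℝ (embed ⁻¹' (dualObjective P T '' Tbar)) - coneK m + {ε • lastUnit m})

/-- `(Tbar, Y)` is a finite `(ε, δ)`-solution of the geometric dual of `P`: `Y` is a finite
`δ`-outer approximation of `𝒫_∞`, and `Tbar` is a finite `ε`-solution of the modified geometric
dual, whose feasible weights lie in `(cone Y)⁺`. -/
def IsFiniteDualSolution (P : CVOP n (m + 1)) (T : Matrix (Fin (m + 1)) (Fin (m + 1)) ℝ)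
    (ε δ : ℝ) (Tbar Y : Set (Vec (m + 1))) : Prop :=
  Y.Finite ∧ P.IsOuterApprox δ Y ∧ IsFiniteDualEpsSolution (P.withCone Y) T ε Tbar

end Dual

end CVO

end

open scoped Pointwise Matrix

noncomputable section

namespace CVO

section

variable {q : ℕ}

/-! ### The scalar product -/

/-! Everything is read through supporting inequalities `(w, b)`: `w` lies in the dual cone, `cᵀw =
1`, and `b` is the attained minimum of `wᵀΓ`. Strong duality (`IsConvex.dot_le_of_optimal`) shows
that each cut comes from such an inequality, and `dualPoint` sends it linearly to the point
`D*(Tᵀw)`.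

For the first phase, the outer directions generate the recession cone of `P0`
(`cone_outerDirections`). Each is within `δ` of a unit recession direction of the upper image, and a
convexity argument extends this to the whole unit-ball section (`isOuterApprox_outerDirections`).
Since the cone generated by `YOut` is the recession cone of `P0`, the weights of the first phase are
nonnegative on it and stay feasible for the modified dual.

For the second phase, let `w` be a feasible weight with `β = inf wᵀΓ`. At termination every
V-representation point is within `ε` of the modified upper image along `c`, and `cᵀw = 1`, so `β - ε
≤ wᵀy` on the final polyhedron. Linear programming duality
(`exists_mem_convexHull_of_forall_polyhedron`) gives a convex combination of recorded inequalities
with weight `w` and right-hand side at least `β - ε`; the normalization by `c` is what turns conic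
multipliers into convex ones. Its image under `dualPoint` is the point needed below `D*(t)`
(`isFiniteDualEpsSolution_of_vRep`). -/

theorem dot_comm (w y : Vec q) : dot w y = dot y w := by
  simp [dot, mul_comm]

theorem dot_add (w y y' : Vec q) : dot w (y + y') = dot w y + dot w y' := by
  simp [dot, mul_add, Finset.sum_add_distrib]

theorem dot_smul (a : ℝ) (w y : Vec q) : dot w (a • y) = a * dot w y := by
  simp only [dot, Finset.mul_sum, PiLp.smul_apply, smul_eq_mul]
  exact Finset.sum_congr rfl fun i _ => by ring

theorem dot_neg (w y : Vec q) : dot w (-y) = -dot w y := by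
  simp [dot]

theorem dot_sub (w y y' : Vec q) : dot w (y - y') = dot w y - dot w y' := by
  rw [sub_eq_add_neg, dot_add, dot_neg, sub_eq_add_neg]

theorem dot_zero (w : Vec q) : dot w 0 = 0 := by
  simp [dot]

theorem smul_dot (a : ℝ) (w y : Vec q) : dot (a • w) y = a * dot w y := by
  rw [dot_comm, dot_smul, dot_comm]

theorem neg_dot (w y : Vec q) : dot (-w) y = -dot w y := by
  rw [dot_comm, dot_neg, dot_comm]

theorem zero_dot (y : Vec q) : dot 0 y = 0 := by
  rw [dot_comm, dot_zero]

theorem continuous_dot (w : Vec q) : Continuous (dot w) := by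
  unfold dot
  fun_prop

theorem dot_self_pos {w : Vec q} (hw : w ≠ 0) : 0 < dot w w := by
  obtain ⟨i, hi⟩ : ∃ i, w i ≠ 0 := by
    by_contra! h
    exact hw (PiLp.ext h)
  exact Finset.sum_pos' (fun j _ => mul_self_nonneg _) ⟨i, Finset.mem_univ i, mul_self_pos.2 hi⟩

theorem exists_eq_dot (f : Vec q →ₗ[ℝ] ℝ) : ∃ w : Vec q, ∀ y, f y = dot w y := by
  refine ⟨WithLp.toLp 1 fun i => f (WithLp.toLp 1 (Pi.single i 1)), fun y => ?_⟩
  have hy : y = ∑ i, y i • (WithLp.toLp 1 (Pi.single i 1) : Vec q) := by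
    ext j
    simp [Pi.single_apply]
  conv_lhs => rw [hy, map_sum]
  simp [dot, mul_comm]

theorem convex_dot_ge (w : Vec q) (b : ℝ) : Convex ℝ {y : Vec q | b ≤ dot w y} := by
  intro y hy y' hy' s t hs ht hst
  simp only [Set.mem_ofPred_eq, dot_add, dot_smul] at *
  calc b = s * b + t * b := by rw [← add_mul, hst, one_mul]
    _ ≤ _ := add_le_add (mul_le_mul_of_nonneg_left hy hs) (mul_le_mul_of_nonneg_left hy' ht)

/-! ### Cones -/

theorem zero_mem_cone (A : Set (Vec q)) : (0 : Vec q) ∈ cone A :=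
  (PointedCone.hull ℝ A).zero_mem

theorem add_mem_cone {A : Set (Vec q)} {y y' : Vec q} (h : y ∈ cone A) (h' : y' ∈ cone A) :
    y + y' ∈ cone A :=
  (PointedCone.hull ℝ A).add_mem h h'

theorem smul_mem_cone {A : Set (Vec q)} {y : Vec q} (h : y ∈ cone A) {a : ℝ} (ha : 0 ≤ a) :
    a • y ∈ cone A :=
  PointedCone.smul_mem (PointedCone.hull ℝ A) ha h

theorem subset_cone (A : Set (Vec q)) : A ⊆ cone A :=
  PointedCone.subset_hull

theorem cone_subset {A B : Set (Vec q)} (h0 : (0 : Vec q) ∈ B)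
    (hadd : ∀ y ∈ B, ∀ y' ∈ B, y + y' ∈ B) (hsmul : ∀ y ∈ B, ∀ a : ℝ, 0 ≤ a → a • y ∈ B)
    (h : A ⊆ B) : cone A ⊆ B := by
  intro y hy
  refine Submodule.span_induction (R := {a : ℝ // 0 ≤ a}) (p := fun y _ => y ∈ B) (fun y hy => h hy) h0
    (fun y y' _ _ hy hy' => hadd y hy y' hy') (fun a y _ hy => hsmul y hy a a.2) hy

theorem convex_cone (A : Set (Vec q)) : Convex ℝ (cone A) :=
  PointedCone.convex _

/-- A nonzero element of the dual cone is positive on interior points. -/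
theorem dot_pos_of_mem_interior {C : Set (Vec q)} {c w : Vec q} (hc : c ∈ interior C)
    (hw : w ∈ dualCone C) (hw0 : w ≠ 0) : 0 < dot w c := by
  have hcont : Filter.Tendsto (fun s : ℝ => c - s • w) (nhdsWithin 0 (Set.Ioi 0)) (nhds c) := by
    have : Continuous fun s : ℝ => c - s • w := by fun_prop
    simpa using (this.tendsto 0).mono_left nhdsWithin_le_nhds
  -- A small step from `c` against `w` stays in `C`, so `wᵀc ≥ s wᵀw > 0`.
  obtain ⟨s, hsC, hs⟩ := ((hcont.eventually (isOpen_interior.mem_nhds hc)).and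
    self_mem_nhdsWithin).exists
  have h := hw _ (interior_subset hsC)
  rw [dot_sub, dot_smul] at h
  have := mul_pos (Set.mem_Ioi.1 hs) (dot_self_pos hw0)
  linarith

/-- Bipolar theorem. -/
theorem mem_of_forall_dualCone {C : Set (Vec q)} (hcl : IsClosed C) (h0 : (0 : Vec q) ∈ C)
    (hconv : Convex ℝ C) (hsmul : ∀ y ∈ C, ∀ a : ℝ, 0 < a → a • y ∈ C) {y : Vec q}
    (hy : ∀ z ∈ dualCone C, 0 ≤ dot z y) : y ∈ C := by
  by_contra hyC
  obtain ⟨f, u, hfy, hfC⟩ := geometric_hahn_banach_point_closed hconv hcl hyC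
  obtain ⟨w, hw⟩ := exists_eq_dot (f : Vec q →ₗ[ℝ] ℝ)
  have hw' : ∀ y, f y = dot w y := hw
  have hu : u < 0 := by simpa using hfC 0 h0
  have hmem : w ∈ dualCone C := by
    intro k hk
    by_contra! hneg
    -- The scaling gives the functional the value `u` exactly, against the strict separation.
    have h1 := hfC _ (hsmul k hk (u / dot w k) (div_pos_of_neg_of_neg hu hneg))
    rw [hw', dot_smul, div_mul_cancel₀ _ hneg.ne] at h1
    exact lt_irrefl _ h1
  have := hy w hmem
  rw [← hw'] at this
  linarith

/-- A convex set with interior points is supported at each point outside its interior. -/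
theorem exists_support {A : Set (Vec q)} (hA : Convex ℝ A) (hint : (interior A).Nonempty)
    {p : Vec q} (hp : p ∉ interior A) : ∃ w : Vec q, w ≠ 0 ∧ ∀ a ∈ A, dot w p ≤ dot w a := by
  obtain ⟨f, hf⟩ := geometric_hahn_banach_open_point hA.interior isOpen_interior hp
  obtain ⟨w, hw⟩ := exists_eq_dot (f : Vec q →ₗ[ℝ] ℝ)
  have hw' : ∀ y, f y = dot w y := hw
  refine ⟨-w, ?_, fun a ha => ?_⟩
  · intro h
    obtain ⟨a, ha⟩ := hint
    have hlt := hf a ha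
    rw [hw', hw', neg_eq_zero.1 h, zero_dot, zero_dot] at hlt
    exact lt_irrefl _ hlt
  · have hcl : a ∈ closure (interior A) := by
      rw [hA.closure_interior_eq_closure_of_nonempty_interior hint]
      exact subset_closure ha
    have hclosed : IsClosed {y : Vec q | dot w y ≤ dot w p} :=
      isClosed_le (continuous_dot w) continuous_const
    have : a ∈ {y : Vec q | dot w y ≤ dot w p} :=
      closure_minimal (fun y hy => by
        have := (hf y hy).le
        rwa [hw', hw'] at this) hclosed hcl
    rw [neg_dot, neg_dot]
    exact neg_le_neg this

/-! ### Polyhedra -/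

/-- The polyhedron with the inequalities `h.2 ≤ h.1ᵀ y`, `h ∈ W`. -/
def polyhedron (W : Set (Vec q × ℝ)) : Set (Vec q) := {y | ∀ h ∈ W, h.2 ≤ dot h.1 y}

theorem convex_polyhedron (W : Set (Vec q × ℝ)) : Convex ℝ (polyhedron W) := by
  have : polyhedron W = ⋂ h ∈ W, {y | h.2 ≤ dot h.1 y} := by
    ext y; simp [polyhedron]
  rw [this]
  exact convex_iInter₂ fun h _ => convex_dot_ge h.1 h.2

theorem isClosed_polyhedron (W : Set (Vec q × ℝ)) : IsClosed (polyhedron W) := by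
  have : polyhedron W = ⋂ h ∈ W, {y | h.2 ≤ dot h.1 y} := by
    ext y; simp [polyhedron]
  rw [this]
  exact isClosed_biInter fun h _ => isClosed_le continuous_const (continuous_dot h.1)

theorem polyhedron_insert (h : Vec q × ℝ) (W : Set (Vec q × ℝ)) :
    polyhedron (insert h W) = polyhedron W ∩ {y | h.2 ≤ dot h.1 y} := by
  ext y
  simp [polyhedron, and_comm]

theorem halfspace_eq (w a : Vec q) : halfspace w a = {y | dot w a ≤ dot w y} := by
  ext y
  simp [halfspace, dot_sub]

/-- A ray along which an affine function stays bounded below has a nonnegative slope. -/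
theorem nonneg_of_forall_le_add_mul {a b s : ℝ} (h : ∀ t : ℝ, 0 ≤ t → b ≤ a + t * s) : 0 ≤ s := by
  by_contra! hs
  have h1 := h ((|b - a| + 1) / -s) (by have := abs_nonneg (b - a); apply div_nonneg <;> linarith)
  have h2 : (|b - a| + 1) / -s * s = -(|b - a| + 1) := by
    rw [div_neg, neg_mul, div_mul_cancel₀ _ hs.ne]
  rw [h2] at h1
  have := neg_abs_le (b - a)
  linarith

/-- One ray inside the polyhedron already forces nonnegative slopes. Nonemptiness matters: every
vector is a recession direction of the empty set. -/
theorem recessionCone_polyhedron {W : Set (Vec q × ℝ)} (hne : (polyhedron W).Nonempty) :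
    recessionCone (polyhedron W) = {d | ∀ h ∈ W, 0 ≤ dot h.1 d} := by
  ext d
  constructor
  · intro hd h hh
    obtain ⟨y, hy⟩ := hne
    refine nonneg_of_forall_le_add_mul (a := dot h.1 y) (b := h.2) fun t ht => ?_
    have := hd y hy t ht h hh
    rwa [dot_add, dot_smul] at this
  · intro hd y hy t ht h hh
    have h1 := hy h hh
    have h2 := mul_nonneg ht (hd h hh)
    rw [dot_add, dot_smul]
    linarith

theorem recessionCone_polyhedron_eq {W : Set (Vec q × ℝ)} (hne : (polyhedron W).Nonempty) :
    recessionCone (polyhedron W) = polyhedron ((fun h => (h.1, 0)) '' W) := by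
  rw [recessionCone_polyhedron hne]
  ext d
  exact (Set.forall_mem_image (f := fun h : Vec q × ℝ => (h.1, (0 : ℝ))) (s := W)
    (p := fun h => h.2 ≤ dot h.1 d)).symm

/-- A polyhedron with finitely many inequalities has finitely many extreme points: an extreme
point is determined by its active inequalities. -/
theorem finite_extremePoints_polyhedron {W : Set (Vec q × ℝ)} (hW : W.Finite) :
    (Set.extremePoints ℝ (polyhedron W)).Finite := by
  refine Set.Finite.of_finite_image
    (f := fun y => {h ∈ W | dot h.1 y = h.2}) (hW.finite_subsets.subset ?_) ?_
  · rintro _ ⟨y, -, rfl⟩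
    exact Set.sep_subset _ _
  · intro x hx y hy hxy
    have hact : ∀ h ∈ W, dot h.1 x = h.2 → dot h.1 y = h.2 := fun h hh hhx =>
      ((Set.ext_iff.1 hxy h).1 ⟨hh, hhx⟩).2
    have hcont : ∀ h : Vec q × ℝ, Filter.Tendsto (fun s : ℝ => dot h.1 (x + s • (x - y)))
        (nhdsWithin 0 (Set.Ioi 0)) (nhds (dot h.1 x)) := by
      intro h
      have : Continuous fun s : ℝ => dot h.1 (x + s • (x - y)) :=
        (continuous_dot h.1).comp (by fun_prop)
      simpa using (this.tendsto 0).mono_left nhdsWithin_le_nhds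
    -- The segment from `y` to `x` can be prolonged beyond `x`: inequalities active at `x` are
    -- active at `y` and constant along the line, the others are slack at `x`.
    have hev : ∀ᶠ s in nhdsWithin (0 : ℝ) (Set.Ioi 0), x + s • (x - y) ∈ polyhedron W := by
      refine (hW.eventually_all (l := nhdsWithin (0 : ℝ) (Set.Ioi 0))
        (p := fun h s => h.2 ≤ dot h.1 (x + s • (x - y)))).2 fun h hh => ?_
      rcases (hx.1 h hh).eq_or_lt with heq | hlt
      · refine Filter.Eventually.of_forall fun s => ?_
        rw [dot_add, dot_smul, dot_sub, hact h hh heq.symm, ← heq]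
        simp
      · exact ((hcont h).eventually (lt_mem_nhds hlt)).mono fun s hs => hs.le
    obtain ⟨s, hsW, hs⟩ := (hev.and self_mem_nhdsWithin).exists
    have hs : 0 < s := hs
    -- These weights write `x` as a proper convex combination of `y` and the prolonged point, so
    -- extremality forces `y = x`.
    refine (hx.2 hy.1 hsW ⟨s / (1 + s), 1 / (1 + s), by positivity, by positivity, ?_, ?_⟩).symm
    · rw [← add_div, add_comm, div_self (by positivity)]
    · have : (1 + s) ≠ 0 := by positivity
      ext i
      simp
      field_simp
      ring

/-- The `ℓ₁` norm is the maximum of finitely many linear forms, one per sign pattern; this makes the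
unit ball a polyhedron. -/
theorem norm_le_iff_forall_signs (y : Vec q) (r : ℝ) :
    ‖y‖ ≤ r ↔ ∀ σ : Fin q → SignType, ∑ i, (σ i : ℝ) * y i ≤ r := by
  rw [PiLp.norm_eq_of_L1]
  constructor
  · intro h σ
    refine (Finset.sum_le_sum fun i _ => ?_).trans h
    rcases h : σ i with _ | _ | _ <;> simp [neg_le_abs, le_abs_self]
  · intro h
    refine (Finset.sum_le_sum fun i _ => ?_).trans (h fun i => SignType.sign (y i))
    rw [sign_mul_self, Real.norm_eq_abs]

theorem closedBall_eq_polyhedron :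
    ∃ W : Set (Vec q × ℝ), W.Finite ∧ Metric.closedBall (0 : Vec q) 1 = polyhedron W := by
  refine ⟨Set.range fun σ : Fin q → SignType => (WithLp.toLp 1 fun i => -(σ i : ℝ), -1),
    Set.finite_range _, ?_⟩
  ext y
  rw [mem_closedBall_zero_iff, norm_le_iff_forall_signs]
  simp [polyhedron, dot]

theorem polyhedron_inter (W W' : Set (Vec q × ℝ)) :
    polyhedron W ∩ polyhedron W' = polyhedron (W ∪ W') := by
  ext y
  simp only [polyhedron, Set.mem_inter_iff, Set.mem_ofPred_eq, Set.mem_union, or_imp, forall_and]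

theorem finite_extremePoints_recessionCone {W : Set (Vec q × ℝ)} (hW : W.Finite)
    (hne : (polyhedron W).Nonempty) :
    (Set.extremePoints ℝ (recessionCone (polyhedron W) ∩ Metric.closedBall 0 1)).Finite := by
  obtain ⟨B, hB, hBeq⟩ := closedBall_eq_polyhedron (q := q)
  rw [hBeq, recessionCone_polyhedron_eq hne, polyhedron_inter]
  exact finite_extremePoints_polyhedron ((hW.image _).union hB)

/-- Krein–Milman; the closure is superfluous because there are only finitely many extreme points. -/
theorem convexHull_extremePoints_recessionCone {W : Set (Vec q × ℝ)} (hW : W.Finite)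
    (hne : (polyhedron W).Nonempty) :
    convexHull ℝ (Set.extremePoints ℝ (recessionCone (polyhedron W) ∩ Metric.closedBall 0 1)) =
      recessionCone (polyhedron W) ∩ Metric.closedBall 0 1 := by
  have hcl : IsClosed (recessionCone (polyhedron W)) := by
    rw [recessionCone_polyhedron_eq hne]
    exact isClosed_polyhedron _
  have hcv : Convex ℝ (recessionCone (polyhedron W)) := by
    rw [recessionCone_polyhedron_eq hne]
    exact convex_polyhedron _
  rw [← ((finite_extremePoints_recessionCone hW hne).isClosed_convexHull ℝ).closure_eq]
  exact closure_convexHull_extremePoints ((isCompact_closedBall 0 1).inter_left hcl)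
    (hcv.inter (convex_closedBall 0 1))

/-- A nonzero recession direction, scaled to norm one, is a convex combination of extreme points of
the unit-ball section. Discarding the extreme point `0` does not change the cone. -/
theorem cone_outerDirections {W : Set (Vec q × ℝ)} (hW : W.Finite)
    (hne : (polyhedron W).Nonempty) :
    cone (outerDirections (polyhedron W)) = recessionCone (polyhedron W) := by
  have hrec := recessionCone_polyhedron hne
  apply Set.Subset.antisymm
  · rw [hrec]
    refine cone_subset (fun h _ => (dot_zero _).ge) (fun y hy y' hy' h hh => ?_)
      (fun y hy a ha h hh => ?_) ?_
    · rw [dot_add]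
      exact add_nonneg (hy h hh) (hy' h hh)
    · rw [dot_smul]
      exact mul_nonneg ha (hy h hh)
    · rw [← hrec]
      exact fun d hd => hd.1.1.1
  · intro y hy
    rcases eq_or_ne y 0 with rfl | hy0
    · exact zero_mem_cone _
    have hpos : 0 < ‖y‖ := norm_pos_iff.2 hy0
    have hmem : ‖y‖⁻¹ • y ∈ recessionCone (polyhedron W) ∩ Metric.closedBall 0 1 := by
      constructor
      · rw [hrec] at hy ⊢
        intro h hh
        rw [dot_smul]
        exact mul_nonneg (by positivity) (hy h hh)
      · rw [mem_closedBall_zero_iff, norm_smul, norm_inv, norm_norm, inv_mul_cancel₀ hpos.ne']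
    rw [← convexHull_extremePoints_recessionCone hW hne] at hmem
    have hsub : convexHull ℝ (Set.extremePoints ℝ
        (recessionCone (polyhedron W) ∩ Metric.closedBall 0 1)) ⊆
        cone (outerDirections (polyhedron W)) := by
      refine convexHull_min (fun d hd => ?_) (convex_cone _)
      by_cases hd0 : d = 0
      · rw [hd0]
        exact zero_mem_cone _
      · exact subset_cone _ ⟨hd, hd0⟩
    have := smul_mem_cone (hsub hmem) hpos.le
    rwa [smul_inv_smul₀ hpos.ne'] at this

end

/-! ### Linear programming duality for normalized inequalities -/

section

variable {n q : ℕ}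

/-- Linear programming duality for normalized inequalities: an inequality valid on a nonempty
polyhedron is dominated by a convex combination of the defining ones. -/
theorem exists_mem_convexHull_of_forall_polyhedron {W : Set (Vec q × ℝ)} (hW : W.Finite)
    (hne : (polyhedron W).Nonempty) {c w : Vec q} (hc : ∀ h ∈ W, dot c h.1 = 1)
    (hcw : dot c w = 1) {b : ℝ} (hb : ∀ y ∈ polyhedron W, b ≤ dot w y) :
    ∃ b', b ≤ b' ∧ (w, b') ∈ convexHull ℝ W := by
  have hcw' : dot w c = 1 := by rw [dot_comm, hcw]
  obtain ⟨h₀, hh₀⟩ : W.Nonempty := by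
    by_contra hemp
    have := hb ((b - 1) • c) (by simp [Set.not_nonempty_iff_eq_empty.1 hemp, polyhedron])
    rw [dot_smul, hcw'] at this
    linarith
  -- The convex combinations of `W` together with all weaker right-hand sides: compact plus closed,
  -- so `(w, b)` can be separated strictly if it is not in this set.
  have hclosed : IsClosed (convexHull ℝ W + ({0} ×ˢ Set.Iic 0 : Set (Vec q × ℝ))) :=
    (isClosed_singleton.prod isClosed_Iic).add_left_of_isCompact (hW.isCompact_convexHull ℝ)
  have hconv : Convex ℝ (convexHull ℝ W + ({0} ×ˢ Set.Iic 0 : Set (Vec q × ℝ))) :=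
    (convex_convexHull ℝ W).add ((convex_singleton 0).prod (convex_Iic 0))
  by_cases hmem : (w, b) ∈ convexHull ℝ W + ({0} ×ˢ Set.Iic 0 : Set (Vec q × ℝ))
  · obtain ⟨⟨a, r⟩, ha, ⟨k, l⟩, ⟨hk, hl⟩, heq⟩ := hmem
    simp only [Prod.mk_add_mk, Prod.mk.injEq, Set.mem_singleton_iff, Set.mem_Iic] at heq hk hl
    refine ⟨r, by linarith [heq.2], ?_⟩
    rwa [← heq.1, hk, add_zero]
  exfalso
  obtain ⟨f, u, hfw, hfA⟩ := geometric_hahn_banach_point_closed hconv hclosed hmem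
  obtain ⟨y, hy⟩ := exists_eq_dot ((f : Vec q × ℝ →ₗ[ℝ] ℝ) ∘ₗ LinearMap.inl ℝ (Vec q) ℝ)
  set s : ℝ := f (0, 1) with hs
  have hf : ∀ a r, f (a, r) = dot a y + r * s := by
    intro a r
    have h1 : ((a, r) : Vec q × ℝ) = (a, 0) + r • (0, 1) := by simp
    have h2 : f (a, 0) = dot y a := hy a
    rw [h1, map_add, map_smul, h2, dot_comm, smul_eq_mul]
  have hW' : ∀ h ∈ W, ∀ k : ℝ, 0 ≤ k → u < dot h.1 y + (h.2 - k) * s := by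
    intro h hh k hk
    rw [← hf]
    refine hfA _ ⟨h, subset_convexHull ℝ W hh, (0, -k), ⟨rfl, ?_⟩, ?_⟩
    · simpa using hk
    · ext <;> simp [sub_eq_add_neg]
  rw [hf] at hfw
  -- The set is unbounded downwards in its last coordinate, so `s ≤ 0`.
  have hs0 : 0 ≤ -s :=
    nonneg_of_forall_le_add_mul (a := dot h₀.1 y + h₀.2 * s) (b := u) fun k hk => by
      linarith [hW' h₀ hh₀ k hk]
  rcases hs0.eq_or_lt with hs0 | hs0
  · have hs0 : s = 0 := by linarith
    -- If `s = 0`, normalization absorbs `u` into `u • c`, and `y - u • c` is a recession direction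
    -- with negative product with `w`; but `w` is bounded below on the polyhedron.
    have hrec : y - u • c ∈ recessionCone (polyhedron W) := by
      rw [recessionCone_polyhedron hne]
      intro h hh
      have := hW' h hh 0 le_rfl
      rw [dot_sub, dot_smul, dot_comm h.1 c, hc h hh]
      rw [hs0] at this
      linarith
    obtain ⟨p, hp⟩ := hne
    have := nonneg_of_forall_le_add_mul (a := dot w p) (b := b) (s := dot w (y - u • c))
      fun t ht => by
        rw [← dot_smul, ← dot_add]
        exact hb _ (hrec p hp t ht)
    rw [dot_sub, dot_smul, hcw'] at this
    rw [hs0] at hfw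
    linarith
  -- If `s < 0`, the separating functional yields a point of the polyhedron that violates `b ≤ wᵀy`.
  · have hmem' : (-s)⁻¹ • (y - u • c) ∈ polyhedron W := by
      intro h hh
      have := hW' h hh 0 le_rfl
      rw [dot_smul, dot_sub, dot_smul, dot_comm h.1 c, hc h hh, inv_mul_eq_div, le_div_iff₀ hs0]
      linarith
    have := hb _ hmem'
    rw [dot_smul, dot_sub, dot_smul, hcw', inv_mul_eq_div, le_div_iff₀ hs0] at this
    linarith

/-! ### Convex problems, strong duality and supporting inequalities -/

namespace CVOP

/-- Convexity of a vector optimization problem: the ordering cone is a convex cone containing `0`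
and the objective is convex with respect to it. -/
structure IsConvex (P : CVOP n q) : Prop where
  X_convex : Convex ℝ P.X
  zero_mem : (0 : Vec q) ∈ P.C
  add_mem : ∀ y ∈ P.C, ∀ y' ∈ P.C, y + y' ∈ P.C
  smul_mem : ∀ y ∈ P.C, ∀ α : ℝ, 0 ≤ α → α • y ∈ P.C
  Γ_convex : ∀ x ∈ P.X, ∀ y ∈ P.X, ∀ α : ℝ, 0 ≤ α → α ≤ 1 →
    α • P.Γ x + (1 - α) • P.Γ y - P.Γ (α • x + (1 - α) • y) ∈ P.C

variable {P : CVOP n q}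

theorem StandingAssumption.isConvex (hP : P.StandingAssumption) : P.IsConvex where
  X_convex := hP.X_convex
  zero_mem := hP.C_ne_zero.1 rfl
  add_mem := hP.C_add
  smul_mem y hy α hα := by
    rcases hα.eq_or_lt with rfl | hα
    · rw [zero_smul]
      exact hP.C_ne_zero.1 rfl
    · exact hP.C_cone y hy α hα
  Γ_convex := hP.Γ_convex

/-- Enlarging the ordering cone only weakens the convexity condition on `Γ`. Pointedness, which can
be lost, is not part of `IsConvex`. -/
theorem IsConvex.withCone (hP : P.IsConvex) {Y : Set (Vec q)} (hY : P.C ⊆ cone Y) :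
    (P.withCone Y).IsConvex where
  X_convex := hP.X_convex
  zero_mem := zero_mem_cone Y
  add_mem _ hy _ hy' := add_mem_cone hy hy'
  smul_mem _ hy _ hα := smul_mem_cone hy hα
  Γ_convex x hx y hy α hα hα' := hY (hP.Γ_convex x hx y hy α hα hα')

theorem IsConvex.convex_C (hP : P.IsConvex) : Convex ℝ P.C :=
  fun _ hy _ hy' _ _ hs ht _ => hP.add_mem _ (hP.smul_mem _ hy _ hs) _ (hP.smul_mem _ hy' _ ht)

theorem IsConvex.convex_image_add (hP : P.IsConvex) : Convex ℝ (P.Γ '' P.X + P.C) := by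
  rintro _ ⟨_, ⟨x, hx, rfl⟩, k, hk, rfl⟩ _ ⟨_, ⟨x', hx', rfl⟩, k', hk', rfl⟩ s t hs ht hst
  obtain rfl : t = 1 - s := by linarith
  refine ⟨_, ⟨s • x + (1 - s) • x', hP.X_convex hx hx' hs ht hst, rfl⟩,
    (s • P.Γ x + (1 - s) • P.Γ x' - P.Γ (s • x + (1 - s) • x')) + (s • k + (1 - s) • k'),
    hP.add_mem _ (hP.Γ_convex x hx x' hx' s hs (by linarith)) _
      (hP.convex_C hk hk' hs ht hst), ?_⟩
  simp only [smul_add]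
  abel

theorem IsConvex.convex_upperImage (hP : P.IsConvex) : Convex ℝ P.upperImage :=
  hP.convex_image_add.closure

theorem P2Feasible.mem {v d : Vec q} {x : Fin n → ℝ} {z : ℝ} (h : P.P2Feasible v d x z) :
    v + z • d ∈ P.Γ '' P.X + P.C :=
  ⟨P.Γ x, ⟨x, h.1, rfl⟩, _, h.2, by simp⟩

/-- If a scalarization is unbounded, its direction is a recession direction. -/
theorem IsConvex.mem_recessionCone_of_P2Unbounded (hP : P.IsConvex) {v d : Vec q}
    (h : P.P2Unbounded v d) : d ∈ recessionCone P.upperImage := by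
  intro y hy α hα
  have hex : ∀ N : ℕ, ∃ z : ℝ, α + N < z ∧ v + z • d ∈ P.upperImage := by
    intro N
    obtain ⟨z, ⟨x, hx⟩, hz⟩ := not_bddAbove_iff.1 h (α + N)
    exact ⟨z, hz, subset_closure hx.mem⟩
  choose z hz hmem using hex
  have hzlim : Filter.Tendsto z Filter.atTop Filter.atTop :=
    Filter.tendsto_atTop_mono (fun N => by have := hz N; linarith) tendsto_natCast_atTop_atTop
  -- These are the points `(1 - α/z) y + (α/z) (v + z d)` of segments inside the upper image; they
  -- tend to `y + α d` as `z` grows.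
  have hlim : Filter.Tendsto (fun N => y + α • d + (α / z N) • (v - y)) Filter.atTop
      (nhds (y + α • d)) := by
    have h0 : Filter.Tendsto (fun N => α / z N) Filter.atTop (nhds 0) :=
      hzlim.const_div_atTop α
    simpa using (tendsto_const_nhds (x := y + α • d)).add (h0.smul_const (v - y))
  refine isClosed_closure.mem_of_tendsto hlim (Filter.Eventually.of_forall fun N => ?_)
  have hzα : α < z N := by
    have := hz N
    have : (0 : ℝ) ≤ N := N.cast_nonneg
    linarith
  have hz0 : 0 < z N := hα.trans_lt hzα
  have h1 : α / z N ≤ 1 := (div_le_one hz0).2 hzα.le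
  have hd : α • d = (α / z N) • z N • d := by
    rw [smul_smul, div_mul_cancel₀ _ hz0.ne']
  have := hP.convex_upperImage hy (hmem N) (sub_nonneg.2 h1) (by positivity : 0 ≤ α / z N)
    (by ring)
  change _ ∈ P.upperImage
  convert this using 1
  rw [hd]
  module

theorem dot_le_of_mem_upperImage {w : Vec q} (hw : w ∈ dualCone P.C) {b : ℝ}
    (hb : ∀ x ∈ P.X, b ≤ dot w (P.Γ x)) {y : Vec q} (hy : y ∈ P.upperImage) : b ≤ dot w y := by
  refine closure_minimal (t := {y | b ≤ dot w y}) ?_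
    (isClosed_le continuous_const (continuous_dot w)) hy
  rintro _ ⟨_, ⟨x, hx, rfl⟩, k, hk, rfl⟩
  have h1 := hb x hx
  have h2 := hw k hk
  simp only [Set.mem_ofPred_eq, dot_add]
  linarith

/-- Strong duality: under a constraint qualification, an optimal solution of the dual
scalarization supports the upper image at the image of an optimal solution of the primal one. -/
theorem IsConvex.dot_le_of_optimal (hP : P.IsConvex) (hint : (interior P.C).Nonempty)
    {v d w : Vec q} {x : Fin n → ℝ} {z : ℝ} (hx : P.P2Optimal v d x z) (hw : P.D2Optimal v d w)
    (hcq : ∀ u ∈ dualCone P.C, u ≠ 0 → (∀ x' ∈ P.X, dot u (v + z • d) ≤ dot u (P.Γ x')) →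
      dot u d < 0) {x' : Fin n → ℝ} (hx' : x' ∈ P.X) : dot w (P.Γ x) ≤ dot w (P.Γ x') := by
  -- At an interior point `z` could still be increased.
  have hp : v + z • d ∉ interior (P.Γ '' P.X + P.C) := by
    intro hp
    have hcont : Filter.Tendsto (fun s : ℝ => v + s • d) (nhdsWithin z (Set.Ioi z))
        (nhds (v + z • d)) := by
      have : Continuous fun s : ℝ => v + s • d := by fun_prop
      exact (this.tendsto z).mono_left nhdsWithin_le_nhds
    obtain ⟨s, hs, hsz⟩ := ((hcont.eventually (isOpen_interior.mem_nhds hp)).and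
      self_mem_nhdsWithin).exists
    obtain ⟨_, ⟨a, ha, rfl⟩, k, hk, hak⟩ := interior_subset hs
    have := hx.2 a s ⟨ha, by rw [← hak]; simpa using hk⟩
    exact (not_le.2 (Set.mem_Ioi.1 hsz)) this
  have hint' : (interior (P.Γ '' P.X + P.C)).Nonempty := by
    obtain ⟨k, hk⟩ := hint
    exact ⟨P.Γ x + k, subset_interior_add_right
      (Set.add_mem_add (Set.mem_image_of_mem P.Γ hx.1.1) hk)⟩
  obtain ⟨u, hu0, hu⟩ := exists_support hP.convex_image_add hint' hp
  have hudual : u ∈ dualCone P.C := by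
    intro k hk
    refine nonneg_of_forall_le_add_mul (a := dot u (P.Γ x)) (b := dot u (v + z • d)) fun t ht => ?_
    rw [← dot_smul, ← dot_add]
    exact hu _ (Set.add_mem_add (Set.mem_image_of_mem P.Γ hx.1.1) (hP.smul_mem k hk t ht))
  have huΓ : ∀ a ∈ P.X, dot u (v + z • d) ≤ dot u (P.Γ a) := fun a ha => by
    simpa using hu _ (Set.add_mem_add (Set.mem_image_of_mem P.Γ ha) hP.zero_mem)
  have hud := hcq u hudual hu0 huΓ
  -- The constraint qualification allows the supporting normal `u` to be scaled to a dual feasible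
  -- point; its dual value is at most `z`, hence so is that of `w`.
  have hpos : 0 < (-dot u d)⁻¹ := inv_pos.2 (neg_pos.2 hud)
  have hfeas : P.D2Feasible d ((-dot u d)⁻¹ • u) := by
    constructor
    · rw [smul_dot, inv_neg, neg_mul, inv_mul_cancel₀ hud.ne]
    · intro k hk
      rw [smul_dot]
      exact mul_nonneg hpos.le (hudual k hk)
  have hval : P.D2Value v ((-dot u d)⁻¹ • u) ≤ ((z : ℝ) : EReal) := by
    have h1 : (⨆ a ∈ P.X, ((-(dot ((-dot u d)⁻¹ • u) (P.Γ a)) : ℝ) : EReal)) ≤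
        ((z - dot ((-dot u d)⁻¹ • u) v : ℝ) : EReal) := by
      refine iSup₂_le fun a ha => ?_
      rw [EReal.coe_le_coe_iff, smul_dot, smul_dot]
      have h2 := huΓ a ha
      rw [dot_add, dot_smul] at h2
      have h3 := mul_le_mul_of_nonneg_left h2 hpos.le
      have h4 : (-dot u d)⁻¹ * dot u d = -1 := by
        rw [inv_neg, neg_mul, inv_mul_cancel₀ hud.ne]
      have h5 : (-dot u d)⁻¹ * (dot u v + z * dot u d) =
          (-dot u d)⁻¹ * dot u v + z * ((-dot u d)⁻¹ * dot u d) := by ring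
      rw [h5, h4] at h3
      linarith
    calc P.D2Value v ((-dot u d)⁻¹ • u)
        ≤ ((z - dot ((-dot u d)⁻¹ • u) v : ℝ) : EReal) +
            ((dot ((-dot u d)⁻¹ • u) v : ℝ) : EReal) := add_le_add_left h1 _
      _ = ((z : ℝ) : EReal) := by rw [← EReal.coe_add, sub_add_cancel]
  have hle : ((-(dot w (P.Γ x')) : ℝ) : EReal) + ((dot w v : ℝ) : EReal) ≤ ((z : ℝ) : EReal) :=
    calc _ ≤ P.D2Value v w := add_le_add_left
            (le_iSup₂ (f := fun a (_ : a ∈ P.X) => ((-(dot w (P.Γ a)) : ℝ) : EReal)) x' hx') _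
      _ ≤ _ := (hw.2 _ hfeas).trans hval
  rw [← EReal.coe_add, EReal.coe_le_coe_iff] at hle
  -- Primal feasibility of `(x, z)` gives `wᵀΓ(x) ≤ wᵀv - z`, and the dual value bounds `wᵀΓ(x')`
  -- below by the same number.
  have hfe := hw.1.2 _ hx.1.2
  rw [dot_sub, dot_add, dot_smul, hw.1.1] at hfe
  linarith

/-- The inequality `h.2 ≤ h.1ᵀ y` is normalized by `c` and supports the upper image of `P` at an
attained value of the objective. -/
structure IsSupport (P : CVOP n q) (c : Vec q) (h : Vec q × ℝ) : Prop where
  norm : dot c h.1 = 1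
  mem_dualCone : h.1 ∈ dualCone P.C
  attained : ∃ x ∈ P.X, dot h.1 (P.Γ x) = h.2
  le : ∀ x ∈ P.X, h.2 ≤ dot h.1 (P.Γ x)

theorem upperImage_subset_polyhedron {c : Vec q} {W : Set (Vec q × ℝ)}
    (hW : ∀ h ∈ W, P.IsSupport c h) : P.upperImage ⊆ polyhedron W :=
  fun _ hy h hh => dot_le_of_mem_upperImage (hW h hh).mem_dualCone (hW h hh).le hy

theorem IsConvex.upperImage_nonempty (hP : P.IsConvex) (hX : P.X.Nonempty) :
    P.upperImage.Nonempty := by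
  obtain ⟨x, hx⟩ := hX
  exact ⟨_, subset_closure (Set.add_mem_add (Set.mem_image_of_mem P.Γ hx) hP.zero_mem)⟩

theorem IsConvex.recessionCone_upperImage_subset (hP : P.IsConvex) (hX : P.X.Nonempty)
    {c : Vec q} {W : Set (Vec q × ℝ)} (hW : ∀ h ∈ W, P.IsSupport c h) :
    recessionCone P.upperImage ⊆ recessionCone (polyhedron W) := by
  obtain ⟨y, hy⟩ := hP.upperImage_nonempty hX
  have hsub := upperImage_subset_polyhedron hW
  rw [recessionCone_polyhedron ⟨y, hsub hy⟩]
  intro d hd h hh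
  refine nonneg_of_forall_le_add_mul (a := dot h.1 y) (b := h.2) fun t ht => ?_
  rw [← dot_smul, ← dot_add]
  exact hsub (hd y hy t ht) h hh

theorem IsConvex.C_subset_recessionCone (hP : P.IsConvex) :
    P.C ⊆ recessionCone P.upperImage := by
  intro d hd y hy α hα
  have hcont : Continuous fun y : Vec q => y + α • d := by fun_prop
  refine map_mem_closure (f := fun y : Vec q => y + α • d) hcont hy ?_
  rintro _ ⟨_, ⟨x, hx, rfl⟩, k, hk, rfl⟩
  exact ⟨P.Γ x, ⟨x, hx, rfl⟩, k + α • d, hP.add_mem _ hk _ (hP.smul_mem _ hd _ hα),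
    (add_assoc _ _ _).symm⟩

theorem IsConvex.convex_recessionCone (hP : P.IsConvex) :
    Convex ℝ (recessionCone P.upperImage) := by
  intro d hd d' hd' s t hs ht hst y hy α hα
  have := hP.convex_upperImage (hd y hy α hα) (hd' y hy α hα) hs ht hst
  convert this using 1
  have hy' : y = s • y + t • y := by rw [← add_smul, hst, one_smul]
  conv_lhs => rw [hy']
  module

end CVOP

end

section

variable {n q m : ℕ}

/-! ### Weights and the geometric dual -/

/-- The last column of `T` is `c`, so the last entry of `Tᵀw` is `cᵀw = 1` and overwriting it by `1`
changes nothing. -/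
theorem weight_tmul {T : Matrix (Fin (m + 1)) (Fin (m + 1)) ℝ} (hT : IsUnit T.det)
    {c : Vec (m + 1)} (hc : ∀ i, T i (Fin.last m) = c i) {w : Vec (m + 1)} (hw : dot c w = 1) :
    weight T (tmul T w) = w := by
  have hlast : (Tᵀ *ᵥ w.ofLp) (Fin.last m) = 1 := by
    rw [← hw]
    simp [Matrix.mulVec, dotProduct, dot, hc]
  have hup : Function.update (Tᵀ *ᵥ w.ofLp) (Fin.last m) 1 = Tᵀ *ᵥ w.ofLp := by
    rw [← hlast, Function.update_eq_self]
  rw [Matrix.mulVec_transpose] at hup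
  unfold weight tmul
  simp only [Matrix.mulVec_transpose, hup, Matrix.vecMul_vecMul, Matrix.mul_nonsing_inv T hT,
    Matrix.vecMul_one]

theorem tmul_weight {T : Matrix (Fin (m + 1)) (Fin (m + 1)) ℝ} (hT : IsUnit T.det)
    (t : Vec (m + 1)) :
    tmul T (weight T t) = WithLp.toLp 1 (Function.update t.ofLp (Fin.last m) 1) := by
  unfold weight tmul
  simp only [Matrix.mulVec_transpose, Matrix.vecMul_vecMul, Matrix.nonsing_inv_mul T hT,
    Matrix.vecMul_one]

theorem dot_weight {T : Matrix (Fin (m + 1)) (Fin (m + 1)) ℝ} (hT : IsUnit T.det)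
    {c : Vec (m + 1)} (hc : ∀ i, T i (Fin.last m) = c i) (t : Vec (m + 1)) :
    dot c (weight T t) = 1 := by
  have h1 : (tmul T (weight T t)) (Fin.last m) = 1 := by
    rw [tmul_weight hT]
    simp
  rw [← h1]
  simp [tmul, Matrix.mulVec, dotProduct, dot, hc]

/-- The point `(Tᵀ w, b)` with the last coordinate of `Tᵀ w` replaced by `b`. -/
def dualPoint (T : Matrix (Fin (m + 1)) (Fin (m + 1)) ℝ) : Vec (m + 1) × ℝ →ₗ[ℝ] Vec (m + 1) where
  toFun h := WithLp.toLp 1 (Function.update (tmul T h.1).ofLp (Fin.last m) h.2)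
  map_add' h h' := by
    ext i
    rcases eq_or_ne i (Fin.last m) with rfl | hi
    · simp
    · simp [hi, tmul, Matrix.mulVec_add]
  map_smul' a h := by
    ext i
    rcases eq_or_ne i (Fin.last m) with rfl | hi
    · simp
    · simp [hi, tmul, Matrix.mulVec_smul]

theorem dualPoint_last (T : Matrix (Fin (m + 1)) (Fin (m + 1)) ℝ) (h : Vec (m + 1) × ℝ) :
    dualPoint T h (Fin.last m) = h.2 := by
  simp [dualPoint]

theorem dualPoint_castSucc (T : Matrix (Fin (m + 1)) (Fin (m + 1)) ℝ) (h : Vec (m + 1) × ℝ)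
    (i : Fin m) : dualPoint T h i.castSucc = tmul T h.1 i.castSucc := by
  simp [dualPoint, (Fin.castSucc_lt_last i).ne]

variable {P : CVOP n (m + 1)} {T : Matrix (Fin (m + 1)) (Fin (m + 1)) ℝ} {c : Vec (m + 1)}

theorem CVOP.IsSupport.iInf_eq {h : Vec (m + 1) × ℝ} (hh : P.IsSupport c h) :
    (⨅ x ∈ P.X, ((dot h.1 (P.Γ x) : ℝ) : EReal)) = ((h.2 : ℝ) : EReal) := by
  obtain ⟨x, hx, hxe⟩ := hh.attained
  refine le_antisymm ?_ (le_iInf₂ fun x hx => EReal.coe_le_coe_iff.2 (hh.le x hx))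
  rw [← hxe]
  exact iInf₂_le x hx

/-- The dictionary between cuts and dual values. Linearity of `dualPoint` then carries convex
combinations of cuts to convex combinations of dual values. -/
theorem dualObjective_tmul (hT : IsUnit T.det) (hc : ∀ i, T i (Fin.last m) = c i)
    {h : Vec (m + 1) × ℝ} (hh : P.IsSupport c h) :
    dualObjective P T (tmul T h.1) = embed (dualPoint T h) := by
  unfold dualObjective embed
  rw [weight_tmul hT hc hh.norm, hh.iInf_eq, dualPoint_last]
  simp only [dualPoint_castSucc]

theorem tmul_mem_dualFeasible (hT : IsUnit T.det) (hc : ∀ i, T i (Fin.last m) = c i)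
    {h : Vec (m + 1) × ℝ} (hh : P.IsSupport c h) : tmul T h.1 ∈ dualFeasible P T := by
  change weight T (tmul T h.1) ∈ dualCone P.C
  rw [weight_tmul hT hc hh.norm]
  exact hh.mem_dualCone

theorem dualObjective_congr {t t' : Vec (m + 1)}
    (h : (fun i : Fin m => t i.castSucc) = fun i => t' i.castSucc) :
    dualObjective P T t = dualObjective P T t' := by
  have hup : Function.update t.ofLp (Fin.last m) 1 = Function.update t'.ofLp (Fin.last m) 1 := by
    ext i
    refine Fin.lastCases ?_ (fun j => ?_) i
    · simp
    · simpa [(Fin.castSucc_lt_last j).ne] using congrFun h j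
  unfold dualObjective weight
  rw [h, hup]

/-- The first coordinates determine the weight and hence the last coordinate of `D*`, so a vertical
line carries at most one value; it is finite here, so adding `k > 0` leaves the image. -/
theorem isKMaximal_dualObjective (hT : IsUnit T.det) (hc : ∀ i, T i (Fin.last m) = c i)
    {h : Vec (m + 1) × ℝ} (hh : P.IsSupport c h) :
    IsKMaximal (dualObjective P T '' dualFeasible P T) (dualObjective P T (tmul T h.1)) := by
  refine ⟨⟨_, tmul_mem_dualFeasible hT hc hh, rfl⟩, ?_⟩
  rintro k hk ⟨t, -, ht⟩
  have h1 : dualObjective P T t = dualObjective P T (tmul T h.1) :=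
    dualObjective_congr (congrArg Prod.fst ht)
  have h2 := congrArg Prod.snd (h1.symm.trans ht)
  rw [dualObjective_tmul hT hc hh] at h2
  simp only [embed] at h2
  rw [← EReal.coe_add, EReal.coe_eq_coe_iff] at h2
  linarith

/-- A lower bound on the points of a V-representation extends to the whole set, for a functional
that is nonnegative on recession directions. -/
theorem IsVRepPoints.dot_le {A : Set (Vec q)} {V : Finset (Vec q)} (hV : IsVRepPoints A V)
    {w : Vec q} (hw : ∀ d ∈ recessionCone A, 0 ≤ dot w d) {b : ℝ} (hb : ∀ v ∈ V, b ≤ dot w v)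
    {y : Vec q} (hy : y ∈ A) : b ≤ dot w y := by
  obtain ⟨-, D, -, rfl⟩ := hV
  obtain ⟨a, ha, d, hd, rfl⟩ := hy
  have h1 : b ≤ dot w a := convexHull_min hb (convex_dot_ge w b) ha
  have h2 : 0 ≤ dot w d := by
    refine hw d ?_
    rintro _ ⟨a', ha', d', hd', rfl⟩ α hα
    exact ⟨a', ha', d' + α • d, add_mem_cone hd' (smul_mem_cone hd hα), (add_assoc _ _ _).symm⟩
  rw [dot_add]
  linarith

/-- An outer approximation of the upper image, all of whose V-representation points are within
`ε` of the upper image along `c`, yields a finite `ε`-solution of the geometric dual. -/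
theorem isFiniteDualEpsSolution_of_vRep (hT : IsUnit T.det) (hc : ∀ i, T i (Fin.last m) = c i)
    (hP : P.IsConvex) (hX : P.X.Nonempty) {W W' : Set (Vec (m + 1) × ℝ)} (hWW' : W ⊆ W')
    (hfin : W'.Finite) (hsupp : ∀ h ∈ W', P.IsSupport c h)
    (hrec : recessionCone (polyhedron W) ⊆ P.C) {V : Finset (Vec (m + 1))}
    (hV : IsVRepPoints (polyhedron W) V) {ε : ℝ}
    (hε : ∀ v ∈ V, ∃ x z, P.P2Feasible v (-c) x z ∧ -z ≤ ε) :
    IsFiniteDualEpsSolution P T ε ((fun h => tmul T h.1) '' W') := by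
  refine ⟨hfin.image _, ?_, ?_, ?_⟩
  · rintro _ ⟨h, hh, rfl⟩
    exact tmul_mem_dualFeasible hT hc (hsupp h hh)
  · rintro _ ⟨h, hh, rfl⟩
    exact isKMaximal_dualObjective hT hc (hsupp h hh)
  rintro _ ⟨t, ht, k, hk, rfl⟩
  have hsub := CVOP.upperImage_subset_polyhedron fun h hh => hsupp h (hWW' hh)
  have hwdual : weight T t ∈ dualCone P.C := ht
  have hcw : dot c (weight T t) = 1 := dot_weight hT hc t
  have hwrec : ∀ d ∈ recessionCone (polyhedron W), 0 ≤ dot (weight T t) d :=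
    fun d hd => hwdual d (hrec hd)
  -- The minimum over the finite set `V` bounds the weight below on the polyhedron, so the infimum
  -- in `D*(t)` is a real number `β`.
  obtain ⟨v₀, -, hv₀⟩ := V.exists_min_image (dot (weight T t)) hV.1
  have hlow : ∀ x ∈ P.X, dot (weight T t) v₀ ≤ dot (weight T t) (P.Γ x) := fun x hx =>
    hV.dot_le hwrec hv₀ (hsub (subset_closure
      (by simpa using Set.add_mem_add (Set.mem_image_of_mem P.Γ hx) hP.zero_mem)))
  obtain ⟨β, hβ⟩ : ∃ β : ℝ,
      (⨅ x ∈ P.X, ((dot (weight T t) (P.Γ x) : ℝ) : EReal)) = ((β : ℝ) : EReal) := by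
    obtain ⟨x, hx⟩ := hX
    refine ⟨_, (EReal.coe_toReal ?_ ?_).symm⟩
    · exact ((iInf₂_le x hx).trans_lt (EReal.coe_lt_top _)).ne
    · exact ((EReal.bot_lt_coe _).trans_le
        (le_iInf₂ fun x hx => EReal.coe_le_coe_iff.2 (hlow x hx))).ne'
  have hβle : ∀ x ∈ P.X, β ≤ dot (weight T t) (P.Γ x) := fun x hx => by
    rw [← EReal.coe_le_coe_iff, ← hβ]
    exact iInf₂_le x hx
  -- Since `cᵀw = 1`, moving from `v` by `-z ≤ ε` along `c` raises `wᵀv` by at most `ε` and reaches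
  -- the modified upper image.
  have hvert : ∀ v ∈ V, β - ε ≤ dot (weight T t) v := by
    intro v hv
    obtain ⟨x, z, hxz, hz⟩ := hε v hv
    have h1 := hwdual _ hxz.2
    have h2 := hβle x hxz.1
    rw [dot_sub, dot_add, dot_smul, dot_neg, dot_comm _ c, hcw] at h1
    linarith
  obtain ⟨b, hb, hmem⟩ := exists_mem_convexHull_of_forall_polyhedron (hfin.subset hWW')
    ((hP.upperImage_nonempty hX).mono hsub) (fun h hh => (hsupp h (hWW' hh)).norm) hcw
    (fun y hy => hV.dot_le hwrec hvert hy)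
  have hmem' : dualPoint T (weight T t, b) ∈
      convexHull ℝ (embed ⁻¹' (dualObjective P T '' ((fun h => tmul T h.1) '' W'))) := by
    have h1 : dualPoint T (weight T t, b) ∈ convexHull ℝ (dualPoint T '' W) := by
      rw [← LinearMap.image_convexHull]
      exact Set.mem_image_of_mem _ hmem
    refine convexHull_mono ?_ h1
    rintro _ ⟨h, hh, rfl⟩
    exact ⟨_, ⟨h, hWW' hh, rfl⟩, dualObjective_tmul hT hc (hsupp h (hWW' hh))⟩
  -- The subtracted multiple is nonnegative because `b ≥ β - ε`, and it leaves `β - k` as last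
  -- coordinate.
  refine ⟨dualPoint T (weight T t, b) - (b + ε - β + k) • lastUnit m + ε • lastUnit m,
    Set.add_mem_add (Set.sub_mem_sub hmem' ⟨_, by linarith, rfl⟩) rfl, ?_⟩
  unfold embed dualObjective
  simp only [PiLp.add_apply, PiLp.sub_apply, dualPoint_last, dualPoint_castSucc, tmul_weight hT,
    hβ]
  refine Prod.ext ?_ ?_
  · ext i
    simp [lastUnit, (Fin.castSucc_lt_last i).ne]
  · rw [← EReal.coe_sub, EReal.coe_eq_coe_iff]
    simp [lastUnit]
    ring

end

section

variable {n q m : ℕ}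

/-! ### Supporting inequalities found by the scalarizations -/

theorem dot_sum (w : Vec q) (R : Finset (Vec q)) : dot w (∑ d ∈ R, d) = ∑ d ∈ R, dot w d := by
  induction R using Finset.cons_induction with
  | empty => simp [dot_zero]
  | cons a s ha ih => rw [Finset.sum_cons, Finset.sum_cons, dot_add, ih]

theorem sum_mem_cone (R : Finset (Vec q)) : ∑ d ∈ R, d ∈ cone (R : Set (Vec q)) :=
  (PointedCone.hull ℝ (R : Set (Vec q))).sum_mem fun _ hd => subset_cone _ hd

/-- A nonzero element of the dual cone of a solid finitely generated cone is positive on the sum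
of the generators. -/
theorem dot_sum_pos {R : Finset (Vec q)} {c w : Vec q}
    (hc : c ∈ interior (cone (R : Set (Vec q)))) (hw : w ∈ dualCone (cone (R : Set (Vec q))))
    (hw0 : w ≠ 0) : 0 < dot w (∑ d ∈ R, d) := by
  have hnn : ∀ d ∈ R, 0 ≤ dot w d := fun d hd => hw d (subset_cone _ hd)
  rw [dot_sum]
  refine (Finset.sum_nonneg hnn).lt_of_ne fun h0 => ?_
  have hz := (Finset.sum_eq_zero_iff_of_nonneg hnn).1 h0.symm
  have hsub : cone (R : Set (Vec q)) ⊆ {y | dot w y ≤ 0} := by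
    refine cone_subset (dot_zero w).le (fun y hy y' hy' => ?_) (fun y hy a ha => ?_)
      fun d hd => (hz d hd).le
    · simp only [Set.mem_ofPred_eq, dot_add] at *
      linarith
    · simp only [Set.mem_ofPred_eq, dot_smul] at *
      exact mul_nonpos_of_nonneg_of_nonpos ha hy
  exact absurd (dot_pos_of_mem_interior hc hw hw0) (not_lt.2 (hsub (interior_subset hc)))

theorem halfspace_smul {a : ℝ} (ha : 0 < a) (w y : Vec q) :
    halfspace (a • w) y = halfspace w y := by
  ext y'
  simp [halfspace, smul_dot, ha]

/-- Every cut is proper, so `M = univ` after a pass certifies that no cut was made. -/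
theorem halfspace_ne_univ {c w : Vec q} (hw : dot c w = 1) (a : Vec q) :
    halfspace w a ≠ Set.univ := by
  intro h
  have : a - c ∈ halfspace w a := h ▸ Set.mem_univ _
  simp only [halfspace, Set.mem_ofPred_eq, sub_sub_cancel_left, dot_neg, dot_comm w c, hw] at this
  linarith

/-- In direction `-c` dual feasibility is itself the normalization, and the constraint qualification
holds because `c` is interior. -/
theorem isSupport_of_vertex {P : CVOP n q} (hP : P.IsConvex) {c : Vec q} (hc : c ∈ interior P.C)
    {v w : Vec q} {x : Fin n → ℝ} {z : ℝ} (hx : P.P2Optimal v (-c) x z)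
    (hw : P.D2Optimal v (-c) w) : P.IsSupport c (w, dot w (P.Γ x)) where
  norm := by
    have := hw.1.1
    rw [dot_neg, dot_comm] at this
    exact neg_injective this
  mem_dualCone := hw.1.2
  attained := ⟨x, hx.1.1, rfl⟩
  le x' hx' := hP.dot_le_of_optimal ⟨c, hc⟩ hx hw (fun u hu hu0 _ => by
    rw [dot_neg]
    exact neg_neg_of_pos (dot_pos_of_mem_interior hc hu hu0)) hx'

variable {P : CVOP n (m + 1)} {I : Input (m + 1)}

/-- The choice of `v` supplies the constraint qualification: `(x₀, 0)` is feasible, so `z ≥ 0`, and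
a supporting normal `u` satisfies `uᵀ(∑ d) + z uᵀd ≤ 0` with a positive first term, whence `uᵀd <
0`. -/
theorem isSupport_of_direction (hP : P.StandingAssumption) (hI : I.Valid P) {x₀ : Fin n → ℝ}
    (hx₀ : x₀ ∈ P.X) {d w : Vec (m + 1)} {x : Fin n → ℝ} {z : ℝ}
    (hx : P.P2Optimal (P.Γ x₀ + ∑ d ∈ I.R, d) d x z)
    (hw : P.D2Optimal (P.Γ x₀ + ∑ d ∈ I.R, d) d w) :
    0 < dot I.c w ∧
      P.IsSupport I.c ((dot I.c w)⁻¹ • w, dot ((dot I.c w)⁻¹ • w) (P.Γ x)) := by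
  have hz : 0 ≤ z := hx.2 x₀ 0 ⟨hx₀, by
    rw [← hI.R_generates]
    simpa using sum_mem_cone I.R⟩
  have hw0 : w ≠ 0 := by
    rintro rfl
    have := hw.1.1
    rw [zero_dot] at this
    linarith
  have hpos : 0 < dot I.c w := by
    rw [dot_comm]
    exact dot_pos_of_mem_interior hI.c_interior hw.1.2 hw0
  refine ⟨hpos, ?_, ?_, ⟨x, hx.1.1, rfl⟩, fun x' hx' => ?_⟩
  · simp only [dot_smul]
    exact inv_mul_cancel₀ hpos.ne'
  · intro k hk
    rw [smul_dot]
    exact mul_nonneg (inv_nonneg.2 hpos.le) (hw.1.2 k hk)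
  · simp only [smul_dot]
    refine mul_le_mul_of_nonneg_left ?_ (inv_nonneg.2 hpos.le)
    refine hP.isConvex.dot_le_of_optimal ⟨_, hI.c_interior⟩ hx hw (fun u hu hu0 hle => ?_) hx'
    have h1 := hle x₀ hx₀
    have h2 : 0 < dot u (∑ d ∈ I.R, d) := by
      refine dot_sum_pos (c := I.c) ?_ ?_ hu0
      · rw [hI.R_generates]
        exact hI.c_interior
      · rw [hI.R_generates]
        exact hu
    rw [dot_add, dot_add, dot_smul] at h1
    exact neg_of_mul_neg_right (by linarith : z * dot u d < 0) hz

/-! ### First phase -/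

/-- `A` is the outer approximation cut out by finitely many supporting inequalities of `P`, whose
weights are recorded in `B`. -/
def HasCuts (P : CVOP n q) (I : Input q) (A B : Set (Vec q)) : Prop :=
  ∃ W : Set (Vec q × ℝ), W.Finite ∧ (∀ h ∈ W, P.IsSupport I.c h) ∧ A = polyhedron W ∧
    B = (fun h => tmul I.T h.1) '' W

theorem HasCuts.inter {P : CVOP n q} {I : Input q} {A B : Set (Vec q)} (h : HasCuts P I A B)
    {w a : Vec q} (hw : P.IsSupport I.c (w, dot w a)) :
    HasCuts P I (A ∩ halfspace w a) (B ∪ {tmul I.T w}) := by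
  obtain ⟨W, hfin, hsupp, rfl, rfl⟩ := h
  refine ⟨insert (w, dot w a) W, hfin.insert _, ?_, ?_, ?_⟩
  · rintro h (rfl | hh)
    · exact hw
    · exact hsupp h hh
  · rw [polyhedron_insert, halfspace_eq]
  · rw [Set.image_insert_eq, Set.union_singleton]

/-- Invariant of the first phase. -/
structure PhaseOneInvariant (P : CVOP n q) (I : Input q) (δ : ℝ) (s : State1 n q) : Prop where
  cuts : HasCuts P I s.P0 s.Tbar
  mem_recessionCone : ∀ r ∈ s.YIn, r ∈ recessionCone P.upperImage
  norm_eq : ∀ r ∈ s.YIn, ‖r‖ = 1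
  near : ∀ d ∈ s.Chat, ∃ r ∈ s.YIn, ‖d - r‖ ≤ δ

theorem phaseOneInvariant_initState (hP : P.StandingAssumption) (hI : I.Valid P) (δ : ℝ) :
    PhaseOneInvariant P I δ (initState I : State1 n (m + 1)) where
  cuts := ⟨∅, Set.finite_empty, by simp, by simp [initState, polyhedron], by simp [initState]⟩
  mem_recessionCone r hr := hP.isConvex.C_subset_recessionCone
    (hI.R_generates ▸ subset_cone _ hr)
  norm_eq r hr := hI.R_norm r hr
  near d hd := hd.elim

/-- The flag `b` is never reset to true, so a true final flag means that every `z` in the list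
contributed a cut. -/
theorem PhaseOneInvariant.boundedness (hI : I.Valid P) {δ : ℝ} {l : List (Vec (m + 1))}
    {s s' : State1 n (m + 1)} (hl : ∀ z ∈ l, z ∈ I.Rs)
    (h : ForEach (boundednessStep P I) l s s') (hs : PhaseOneInvariant P I δ s) :
    PhaseOneInvariant P I δ s' ∧ s'.P0 ⊆ s.P0 ∧
      (s'.b = true → s.b = true ∧ ∀ z ∈ l, ∃ a, s'.P0 ⊆ halfspace z a) := by
  induction h with
  | nil s => exact ⟨hs, subset_rfl, by simp⟩
  | @cons z l s s₁ s₂ hstep _ ih =>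
    rcases hstep with ⟨-, rfl⟩ | ⟨x, hx, rfl⟩
    · obtain ⟨h1, h2, h3⟩ := ih (fun z hz => hl z (List.mem_cons_of_mem _ hz))
        ⟨hs.cuts, hs.mem_recessionCone, hs.norm_eq, hs.near⟩
      exact ⟨h1, h2, fun hb => absurd (h3 hb).1 (by simp)⟩
    · have hz : z ∈ I.Rs := hl z List.mem_cons_self
      have hsupp : P.IsSupport I.c (z, dot z (P.Γ x)) :=
        ⟨hI.Rs_norm z hz, hI.Rs_generates ▸ subset_cone _ hz, ⟨x, hx.1, rfl⟩, hx.2⟩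
      obtain ⟨h1, h2, h3⟩ := ih (fun z hz => hl z (List.mem_cons_of_mem _ hz))
        ⟨hs.cuts.inter hsupp, hs.mem_recessionCone, hs.norm_eq, hs.near⟩
      refine ⟨h1, h2.trans Set.inter_subset_left, fun hb => ⟨(h3 hb).1, fun z' hz' => ?_⟩⟩
      rcases List.mem_cons.1 hz' with rfl | hz'
      · exact ⟨_, h2.trans Set.inter_subset_right⟩
      · exact (h3 hb).2 z' hz'

theorem HasCuts.inter_direction (hP : P.StandingAssumption) (hI : I.Valid P) {x₀ : Fin n → ℝ}
    (hx₀ : x₀ ∈ P.X) {A B : Set (Vec (m + 1))} (h : HasCuts P I A B) {d w : Vec (m + 1)}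
    {x : Fin n → ℝ} {z : ℝ} (hx : P.P2Optimal (P.Γ x₀ + ∑ d ∈ I.R, d) d x z)
    (hw : P.D2Optimal (P.Γ x₀ + ∑ d ∈ I.R, d) d w) :
    HasCuts P I (A ∩ halfspace w (P.Γ x)) (B ∪ {tmul I.T ((dot I.c w)⁻¹ • w)}) := by
  obtain ⟨hpos, hsupp⟩ := isSupport_of_direction hP hI hx₀ hx hw
  rw [← halfspace_smul (inv_pos.2 hpos) w]
  exact h.inter hsupp

theorem PhaseOneInvariant.insert_YIn {P : CVOP n q} {I : Input q} {δ : ℝ} {s : State1 n q}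
    (hs : PhaseOneInvariant P I δ s) {d : Vec q} (hd : d ∈ recessionCone P.upperImage)
    (hn : ‖d‖ = 1) : PhaseOneInvariant P I δ { s with YIn := s.YIn ∪ {d} } where
  cuts := hs.cuts
  mem_recessionCone := by
    rintro r (hr | rfl)
    · exact hs.mem_recessionCone r hr
    · exact hd
  norm_eq := by
    rintro r (hr | rfl)
    · exact hs.norm_eq r hr
    · exact hn
  near e he := by
    obtain ⟨r, hr, hre⟩ := hs.near e he
    exact ⟨r, Or.inl hr, hre⟩

theorem PhaseOneInvariant.lineality (hP : P.StandingAssumption) (hI : I.Valid P) {δ : ℝ}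
    {x₀ : Fin n → ℝ} (hx₀ : x₀ ∈ P.X) {l : List (Vec (m + 1))} {s s' : State1 n (m + 1)}
    (hl : ∀ d ∈ l, ‖d‖ = 1)
    (h : ForEach (linealityStep P I (P.Γ x₀ + ∑ d ∈ I.R, d)) l s s')
    (hs : PhaseOneInvariant P I δ s) : PhaseOneInvariant P I δ s' := by
  induction h with
  | nil s => exact hs
  | @cons d l s s₁ s₂ hstep _ ih =>
    refine ih (fun d hd => hl d (List.mem_cons_of_mem _ hd)) ?_
    rcases hstep with ⟨hunb, rfl⟩ | ⟨x, z, w, hx, hw, rfl⟩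
    · exact hs.insert_YIn (hP.isConvex.mem_recessionCone_of_P2Unbounded hunb)
        (hl d List.mem_cons_self)
    · exact ⟨hs.cuts.inter_direction hP hI hx₀ hx hw, hs.mem_recessionCone, hs.norm_eq, hs.near⟩

theorem smul_mem_recessionCone {A : Set (Vec q)} {d : Vec q} (hd : d ∈ recessionCone A) {a : ℝ}
    (ha : 0 ≤ a) : a • d ∈ recessionCone A := by
  intro y hy α hα
  rw [smul_smul]
  exact hd y hy _ (mul_nonneg hα ha)

theorem PhaseOneInvariant.loop (hP : P.StandingAssumption) (hI : I.Valid P) {δ : ℝ}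
    {x₀ : Fin n → ℝ} (hx₀ : x₀ ∈ P.X) {s s' : State1 n (m + 1)}
    (h : loopStep P I δ (P.Γ x₀ + ∑ d ∈ I.R, d) s s') (hs : PhaseOneInvariant P I δ s)
    (hY : s.YOut = outerDirections s.P0) :
    PhaseOneInvariant P I δ s' ∧ s'.YOut = outerDirections s'.P0 := by
  obtain ⟨d, -, r, hr, -, ⟨hdr, rfl⟩ | ⟨-, l, -, -, he, hstep⟩⟩ := h
  · refine ⟨⟨hs.cuts, hs.mem_recessionCone, hs.norm_eq, ?_⟩, hY⟩
    rintro d' (hd' | rfl)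
    · exact hs.near d' hd'
    · exact ⟨r, hr, hdr⟩
  · rcases hstep with ⟨hunb, rfl⟩ | ⟨x, z, w, hx, hw, rfl⟩
    · refine ⟨hs.insert_YIn (smul_mem_recessionCone
        (hP.isConvex.mem_recessionCone_of_P2Unbounded hunb) (by positivity)) ?_, hY⟩
      rw [norm_smul, norm_inv, norm_norm, inv_mul_cancel₀ (norm_ne_zero_iff.2 he)]
    · exact ⟨⟨hs.cuts.inter_direction hP hI hx₀ hx hw, hs.mem_recessionCone, hs.norm_eq, hs.near⟩,
        rfl⟩

/-- If every outer direction is within `δ` of a recession direction of norm one, the outer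
directions form a `δ`-outer approximation. -/
theorem isOuterApprox_outerDirections {P : CVOP n q} (hP : P.IsConvex) (hX : P.X.Nonempty)
    {c : Vec q} {W : Set (Vec q × ℝ)} (hW : W.Finite) (hsupp : ∀ h ∈ W, P.IsSupport c h) {δ : ℝ}
    (hδ : 0 ≤ δ) (hnear : ∀ d ∈ outerDirections (polyhedron W),
      ∃ r ∈ recessionCone P.upperImage, ‖r‖ = 1 ∧ ‖d - r‖ ≤ δ) :
    P.IsOuterApprox δ (outerDirections (polyhedron W)) := by
  have hne := (hP.upperImage_nonempty hX).mono (CVOP.upperImage_subset_polyhedron hsupp)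
  have hsub := hP.recessionCone_upperImage_subset hX hsupp
  unfold CVOP.IsOuterApprox
  rw [cone_outerDirections hW hne]
  refine ⟨hsub, Metric.hausdorffDist_le_of_mem_dist hδ
    (fun y hy => ⟨y, ⟨hsub hy.1, hy.2⟩, by simpa using hδ⟩) fun y hy => ?_⟩
  rw [← convexHull_extremePoints_recessionCone hW hne] at hy
  -- The `δ`-neighbourhood of a convex set is convex; containing all extreme points, `0` included,
  -- it contains their hull.
  have hconv : Convex ℝ ((recessionCone P.upperImage ∩ Metric.closedBall 0 1) +
      Metric.closedBall (0 : Vec q) δ) :=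
    (hP.convex_recessionCone.inter (convex_closedBall 0 1)).add (convex_closedBall 0 δ)
  have hmem := convexHull_min (fun d hd => ?_) hconv hy
  · obtain ⟨r, hr, e, he, rfl⟩ := hmem
    exact ⟨r, hr, by simpa using he⟩
  · by_cases hd0 : d = 0
    · refine ⟨0, ⟨hP.C_subset_recessionCone hP.zero_mem, by simp⟩, 0, by simpa using hδ, ?_⟩
      simp [hd0]
    · obtain ⟨r, hr, hr1, hdr⟩ := hnear d ⟨hd, hd0⟩
      exact ⟨r, ⟨hr, by simp [hr1]⟩, d - r, by simpa using hdr, by simp⟩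

/-- The first phase yields an outer approximation of the upper image whose recession cone is
generated by the finite `δ`-outer approximation `YOut`. -/
theorem Phase1Terminates.result (hP : P.StandingAssumption) (hI : I.Valid P) {δ : ℝ}
    (hδ : 0 < δ) {s : State1 n (m + 1)} (h : Phase1Terminates P I δ s) :
    HasCuts P I s.P0 s.Tbar ∧ cone s.YOut = recessionCone s.P0 ∧ s.YOut.Finite ∧
      P.IsOuterApprox δ s.YOut := by
  obtain ⟨x₀, hx₀, lz, hlz, s₃, hb, hcase⟩ := h
  obtain ⟨h₃, -, hbd⟩ := (phaseOneInvariant_initState hP hI δ).boundedness hI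
    (fun z hz => (hlz.2 z).1 hz) hb
  have hX : P.X.Nonempty := ⟨x₀, hx₀⟩
  rcases hcase with ⟨htrue, rfl⟩ | ⟨-, lr, hlr, s₅, hlin, hloop, hend⟩
  -- Without unbounded problems each generator of the dual cone gives a cut, so the bipolar theorem
  -- bounds the recession cone by `C`. The approximation by `R` is then exact.
  · have hrec : recessionCone s₃.P0 ⊆ P.C := by
      intro d hd
      refine mem_of_forall_dualCone hP.C_closed hP.isConvex.zero_mem hP.isConvex.convex_C hP.C_cone
        fun z hz => ?_
      obtain ⟨y, hy⟩ : s₃.P0.Nonempty := by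
        obtain ⟨W, -, hsupp, hW, -⟩ := h₃.cuts
        rw [hW]
        exact (hP.isConvex.upperImage_nonempty hX).mono (CVOP.upperImage_subset_polyhedron hsupp)
      rw [← hI.Rs_generates] at hz
      refine cone_subset (B := {z | 0 ≤ dot z d}) (zero_dot d).ge (fun a ha a' ha' => ?_)
        (fun a ha t ht => ?_) (fun z hz => ?_) hz
      · simp only [Set.mem_ofPred_eq, dot_comm _ d, dot_add] at *
        exact add_nonneg ha ha'
      · simp only [Set.mem_ofPred_eq, smul_dot] at *
        exact mul_nonneg ht ha
      · obtain ⟨a, ha⟩ := (hbd htrue).2 z ((hlz.2 z).2 hz)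
        refine nonneg_of_forall_le_add_mul (a := dot z y) (b := dot z a) fun t ht => ?_
        have := ha (hd y hy t ht)
        rwa [halfspace_eq, Set.mem_ofPred_eq, dot_add, dot_smul] at this
    have hsub : recessionCone P.upperImage ⊆ recessionCone s₃.P0 := by
      obtain ⟨W, -, hsupp, hW, -⟩ := h₃.cuts
      rw [hW]
      exact hP.isConvex.recessionCone_upperImage_subset hX hsupp
    have hC : P.C = recessionCone P.upperImage :=
      hP.isConvex.C_subset_recessionCone.antisymm (hsub.trans hrec)
    refine ⟨h₃.cuts, ?_, I.R.finite_toSet, ?_⟩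
    · simp only [hI.R_generates]
      exact (hC.le.trans hsub).antisymm hrec
    · refine ⟨?_, ?_⟩
      · rw [hI.R_generates, ← hC]
      · rw [hI.R_generates, ← hC, Metric.hausdorffDist_self_zero]
        exact hδ.le
  · have h₅ : PhaseOneInvariant P I δ s₅ := by
      refine h₃.lineality hP hI hx₀ (fun d hd => ?_) hlin
      obtain ⟨r, hr, rfl⟩ := List.mem_map.1 hd
      rw [norm_neg]
      exact hI.R_norm r ((hlr.2 r).1 hr)
    have hout : PhaseOneInvariant P I δ s ∧ s.YOut = outerDirections s.P0 := by
      clear hend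
      induction hloop with
      | refl => exact ⟨⟨h₅.cuts, h₅.mem_recessionCone, h₅.norm_eq, h₅.near⟩, rfl⟩
      | tail _ hstep ih => exact ih.1.loop hP hI hx₀ hstep ih.2
    obtain ⟨hs, hY⟩ := hout
    have hnear : ∀ d ∈ outerDirections s.P0,
        ∃ r ∈ recessionCone P.upperImage, ‖r‖ = 1 ∧ ‖d - r‖ ≤ δ := by
      intro d hd
      rw [← hY] at hd
      -- Loop exit leaves only directions that are themselves recession directions or were found
      -- `δ`-close to one.
      rcases Set.sdiff_eq_empty.1 hend hd with hd | hd
      · exact ⟨d, hs.mem_recessionCone d hd, hs.norm_eq d hd, by simpa using hδ.le⟩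
      · obtain ⟨r, hr, hdr⟩ := hs.near d hd
        exact ⟨r, hs.mem_recessionCone r hr, hs.norm_eq r hr, hdr⟩
    refine ⟨hs.cuts, ?_⟩
    obtain ⟨W, hW, hsupp, hWeq, -⟩ := hs.cuts
    rw [hWeq] at hY hnear ⊢
    rw [hY]
    have hne := (hP.isConvex.upperImage_nonempty hX).mono
      (CVOP.upperImage_subset_polyhedron hsupp)
    exact ⟨cone_outerDirections hW hne,
      (finite_extremePoints_recessionCone hW hne).subset Set.sdiff_subset,
      isOuterApprox_outerDirections hP.isConvex hX hW hsupp hδ.le hnear⟩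

end

section

variable {n q m : ℕ}

/-! ### Second phase -/

/-- Treatment of all points of a V-representation: the recorded weights come from supporting
inequalities `W'`, some of which cut out `M`; without cuts all points are `ε`-close to the upper
image. -/
theorem forEach_vertexStep {P : CVOP n q} (hP : P.IsConvex) {I : Input q}
    (hc : I.c ∈ interior P.C) {ε : ℝ} {l : List (Vec q)} {s s' : State2 n q}
    (h : ForEach (vertexStep P I ε) l s s') {U W' : Set (Vec q × ℝ)} (hU : U ⊆ W')
    (hfin : W'.Finite) (hsupp : ∀ h ∈ W', P.IsSupport I.c h)
    (hT : s.Tbar = (fun h => tmul I.T h.1) '' W') (hM : s.M = polyhedron U) :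
    s'.Pk = s.Pk ∧ s'.M ⊆ s.M ∧
      (∃ U' W'' : Set (Vec q × ℝ), U' ⊆ W'' ∧ W' ⊆ W'' ∧ W''.Finite ∧
        (∀ h ∈ W'', P.IsSupport I.c h) ∧ s'.Tbar = (fun h => tmul I.T h.1) '' W'' ∧
        s'.M = polyhedron U') ∧
      (s'.M = Set.univ → ∀ v ∈ l, ∃ x z, P.P2Feasible v (-I.c) x z ∧ -z ≤ ε) := by
  induction h generalizing U W' with
  | nil s => exact ⟨rfl, subset_rfl, ⟨U, W', hU, subset_rfl, hfin, hsupp, hT, hM⟩, by simp⟩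
  | @cons v l s s₁ s₂ hstep _ ih =>
    obtain ⟨x, z, w, hx, hw, hcase⟩ := hstep
    have hnew := isSupport_of_vertex hP hc hx hw
    have hsupp' : ∀ h ∈ insert (w, dot w (P.Γ x)) W', P.IsSupport I.c h := by
      rintro h (rfl | hh)
      · exact hnew
      · exact hsupp h hh
    have hT' : s.Tbar ∪ {tmul I.T w} =
        (fun h => tmul I.T h.1) '' insert (w, dot w (P.Γ x)) W' := by
      rw [Set.image_insert_eq, Set.union_singleton, hT]
    rcases hcase with ⟨-, rfl⟩ | ⟨hz, rfl⟩
    · obtain ⟨h1, h2, ⟨U', W'', h3, h4, h5⟩, h6⟩ := ih (U := insert (w, dot w (P.Γ x)) U)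
        (Set.insert_subset_insert hU) (hfin.insert _) hsupp' hT'
        (by rw [polyhedron_insert, hM, halfspace_eq])
      refine ⟨h1, h2.trans Set.inter_subset_left,
        ⟨U', W'', h3, (Set.subset_insert _ _).trans h4, h5⟩, fun huniv => ?_⟩
      -- Later steps only shrink `M`, so a cut made here excludes `M = univ` at the end.
      exact absurd (Set.univ_subset_iff.1 (huniv ▸ h2.trans Set.inter_subset_right))
        (halfspace_ne_univ hnew.norm _)
    · obtain ⟨h1, h2, ⟨U', W'', h3, h4, h5⟩, h6⟩ := ih (U := U)
        (hU.trans (Set.subset_insert _ _)) (hfin.insert _) hsupp' hT' hM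
      refine ⟨h1, h2, ⟨U', W'', h3, (Set.subset_insert _ _).trans h4, h5⟩, fun huniv v' hv' => ?_⟩
      rcases List.mem_cons.1 hv' with rfl | hv'
      · exact ⟨x, z, hx.1, hz⟩
      · exact h6 huniv v' hv'

/-- Invariant of the second phase, started with the inequalities `W₀`: the current approximation
is cut out by some of the recorded inequalities, and if the loop has stopped, the points of a
V-representation are `ε`-close to the upper image. -/
def PhaseTwoInvariant (P : CVOP n q) (I : Input q) (ε : ℝ) (W₀ : Set (Vec q × ℝ))
    (s : State2 n q) : Prop :=
  ∃ W W' : Set (Vec q × ℝ), W₀ ⊆ W ∧ W ⊆ W' ∧ W'.Finite ∧ (∀ h ∈ W', P.IsSupport I.c h) ∧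
    s.Tbar = (fun h => tmul I.T h.1) '' W' ∧ s.Pk = polyhedron W ∧
    (s.M = Set.univ → ∃ V : Finset (Vec q), IsVRepPoints (polyhedron W) V ∧
      ∀ v ∈ V, ∃ x z, P.P2Feasible v (-I.c) x z ∧ -z ≤ ε)

theorem PhaseTwoInvariant.outerStep {P : CVOP n q} (hP : P.IsConvex) {I : Input q}
    (hc : I.c ∈ interior P.C) {ε : ℝ} {W₀ : Set (Vec q × ℝ)} {s s' : State2 n q}
    (hs : PhaseTwoInvariant P I ε W₀ s) (h : outerStep P I ε s s') :
    PhaseTwoInvariant P I ε W₀ s' := by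
  obtain ⟨W, W', hW₀, hWW', hfin, hsupp, hT, hPk, -⟩ := hs
  obtain ⟨-, V, hV, l, hl, s₁, hfor, hcase⟩ := h
  -- A pass starts from `M = univ`, the polyhedron of no inequalities.
  obtain ⟨h1, -, ⟨U, W'', hU, hW'', hfin', hsupp', hT', hM⟩, hclose⟩ :=
    forEach_vertexStep hP hc hfor (Set.empty_subset W') hfin hsupp hT (by simp [polyhedron])
  have h1 : s₁.Pk = polyhedron W := h1.trans hPk
  rcases hcase with ⟨hne, rfl⟩ | ⟨huniv, rfl⟩
  · refine ⟨W ∪ U, W'', hW₀.trans Set.subset_union_left, Set.union_subset (hWW'.trans hW'') hU,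
      hfin', hsupp', hT', ?_, fun h => absurd h hne⟩
    rw [← polyhedron_inter, h1, hM]
  · refine ⟨W, W'', hW₀, hWW'.trans hW'', hfin', hsupp', hT', h1, fun _ => ⟨V, hPk ▸ hV, ?_⟩⟩
    exact fun v hv => hclose huniv v ((hl.2 v).2 hv)

end

end CVO

end

/-! ### Assembly of the two phases -/

theorem mainTheorem3 {n m : ℕ} (P : CVO.CVOP n (m + 1)) (hP : P.StandingAssumption)
    (I : CVO.Input (m + 1)) (hI : I.Valid P) (ε δ : ℝ) (hε : 0 < ε) (hδ : 0 < δ)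
    (Xbar : Set (Fin n → ℝ)) (YOut Tbar : Set (CVO.Vec (m + 1)))
    (hrun : CVO.PrimalAlgorithmTerminates P I ε δ Xbar YOut Tbar) :
    CVO.IsFiniteDualSolution P I.T ε δ Tbar YOut := by
  obtain ⟨s, out, hphase, hloop, hout, -, rfl, rfl⟩ := hrun
  obtain ⟨⟨W₀, hfin₀, hsupp₀, hP0, hT₀⟩, hcone, hYfin, happrox⟩ := hphase.result hP hI hδ
  have hX : P.X.Nonempty := hP.X_interior.mono interior_subset
  have hsub : P.C ⊆ CVO.cone s.YOut :=
    hP.isConvex.C_subset_recessionCone.trans happrox.1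
  have hP' : (P.withCone s.YOut).IsConvex := hP.isConvex.withCone hsub
  have hc : I.c ∈ interior (P.withCone s.YOut).C := interior_mono hsub hI.c_interior
  have hrec₀ : CVO.cone s.YOut = {d | ∀ h ∈ W₀, 0 ≤ CVO.dot h.1 d} := by
    rw [hcone, hP0, CVO.recessionCone_polyhedron ((hP.isConvex.upperImage_nonempty hX).mono
      (CVO.CVOP.upperImage_subset_polyhedron hsupp₀))]
  -- The new cone is the recession cone of `P0`, on which all weights of `W₀` are nonnegative;
  -- nothing else in the support condition depends on the cone.
  have hsupp₀' : ∀ h ∈ W₀, (P.withCone s.YOut).IsSupport I.c h := fun h hh =>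
    ⟨(hsupp₀ h hh).norm, fun y hy => hrec₀.le hy h hh, (hsupp₀ h hh).attained, (hsupp₀ h hh).le⟩
  have hinv : CVO.PhaseTwoInvariant (P.withCone s.YOut) I ε W₀ out := by
    clear hout
    induction hloop with
    -- The initial `M = ∅` is not `univ`, so the stopping clause is vacuous before the first pass.
    | refl => exact ⟨W₀, W₀, subset_rfl, subset_rfl, hfin₀, hsupp₀', hT₀, hP0,
        fun h => absurd h Set.empty_ne_univ⟩
    | tail _ hstep ih => exact ih.outerStep hP' hc hstep
  obtain ⟨W, W', hW₀, hWW', hfin, hsupp, hT, -, hclose⟩ := hinv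
  obtain ⟨V, hV, hVε⟩ := hclose hout
  refine ⟨hYfin, happrox, ?_⟩
  rw [hT]
  refine CVO.isFiniteDualEpsSolution_of_vRep hI.T_nonsingular hI.T_last hP' hX hWW' hfin hsupp
    ?_ hV hVε
  change CVO.recessionCone (CVO.polyhedron W) ⊆ CVO.cone s.YOut
  -- Further cuts only shrink the recession cone, and `W₀` is still among the inequalities.
  rw [hrec₀, CVO.recessionCone_polyhedron ((hP'.upperImage_nonempty hX).mono
    (CVO.CVOP.upperImage_subset_polyhedron fun h hh => hsupp h (hWW' hh)))]
  exact fun d hd h hh => hd h (hW₀ hh)
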